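/- Let $n_i,m_i,k_i$ ($i=1,2$), $p,q$ be nonnegative integers, and let $\mathcal P=\begin{bmatrix}\mathcal P_{11}&\mathcal P_{12}\\ \mathcal P_{21}&\mathcal P_{22}\end{bmatrix}$ be a proper real rational transfer function with inputs $(w,u)\in\mathbb R^{q}\times\mathbb R^{m_1+m_2}$, outputs $(z,y)\in\mathbb R^{p}\times\mathbb R^{k_1+k_2}$, and minimal realization $$\mathcal P=\left[\begin{array}{c|cc}A&B_1&B_2\\ \hline C_1&0&D_{12}\\ C_2&D_{21}&0\end{array}\right],\quad A=\begin{bmatrix}A_{11}&0\\A_{21}&A_{22}\end{bmatrix},\quad B_2=\begin{bmatrix}B_{11}&0\\B_{21}&B_{22}\end{bmatrix},\quad C_2=\begin{bmatrix}C_{11}&0\\C_{21}&C_{22}\end{bmatrix},$$ where $A_{ij}\in\mathbb R^{n_i\times n_j}$, $B_{ij}\in\mathbb R^{n_i\times m_j}$, $C_{ij}\in\mathbb R^{k_i\times n_j}$; here $\left[\begin{array}{c|c}A&B\\ \hline C&D\end{array}\right]$ denotes $D+C(sI-A)^{-1}B$. Suppose that $(A_{ii},B_{ii})$ is stabilizable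 and $(C_{ii},A_{ii})$ is detectable for $i=1,2$. Choose any $K_i,L_i$ such that $A_{ii}+B_{ii}K_i$ and $A_{ii}+L_iC_{ii}$ are Hurwitz (all eigenvalues have negative real part), and put $K_d=\operatorname{diag}(K_1,K_2)$, $L_d=\operatorname{diag}(L_1,L_2)$, $$\mathcal J_d=\left[\begin{array}{c|cc}A+B_2K_d+L_dC_2&-L_d&B_2\\ \hline K_d&0&I\\-C_2&I&0\end{array}\right],$$ $$\begin{bmatrix}\mathcal T_{11}&\mathcal T_{12}\\ \mathcal T_{21}&0\end{bmatrix}=\left[\begin{array}{cc|cc}A+B_2K_d&-B_2K_d&B_1&B_2\\0&A+L_dC_2&B_1+L_dD_{21}&0\\ \hline C_1+D_{12}K_d&-D_{12}K_d&0&D_{12}\\0&C_2&D_{21}&0\end{array}\right].$$ Let $\mathcal R_p$ be the set of proper real rational functions and $\mathcal{RH}_\infty$ the set of those with all poles in the open left half-plane; $\mathrm{Lower}(\cdot)$ denotes the $(m_1+m_2)\times(k_1+k_2)$ matrices with entries in the given set whose $(1,2)$ block ($m_1\times k_2$) vanishes. Let $F_\ell(\mathcal M,\mathcal K)=\mathcal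 M_{11}+\mathcal M_{12}\mathcal K(I-\mathcal M_{22}\mathcal K)^{-1}\mathcal M_{21}$, and let $\|\mathcal G\|_2=\bigl(\frac1{2\pi}\int_{-\infty}^{\infty}\operatorname{tr}(\mathcal G(i\omega)^*\mathcal G(i\omega))\,d\omega\bigr)^{1/2}\in[0,\infty]$. A proper $\mathcal K$ stabilizes $\mathcal P$ if $I-\mathcal P_{22}(\infty)\mathcal K(\infty)$ is nonsingular and the transfer function $(w,u_1,u_2)\mapsto(z,y_1,y_2)$ defined by $z=\mathcal P_{11}w+\mathcal P_{12}y_2$, $y_1=u_1+\mathcal P_{21}w+\mathcal P_{22}y_2$, $y_2=u_2+\mathcal Ky_1$ has all its entries in $\mathcal{RH}_\infty$. Consider the model-matching problem $$\text{minimize }\ \|\mathcal T_{11}+\mathcal T_{12}\mathcal Q\mathcal T_{21}\|_2\quad\text{over }\mathcal Q\in\mathrm{Lower}(\mathcal{RH}_\infty)\tag{1}$$ and the two-player problem $$\text{minimize }\ \|F_\ell(\mathcal P,\mathcal K)\|_2\quad\text{over }\mathcal K\in\mathrm{Lower}(\mathcal R_p)\text{ that stabilize }\mathcal P.\tag{2}$$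 Then: (a) the set of all $\mathcal K\in\mathrm{Lower}(\mathcal R_p)$ that stabilize $\mathcal P$ equals $\{F_\ell(\mathcal J_d,\mathcal Q) : \mathcal Q\in\mathrm{Lower}(\mathcal{RH}_\infty)\}$; (b) for every $(m_1+m_2)\times(k_1+k_2)$ matrix $\mathcal Q_{\rm opt}$ over $\mathcal R_p$ (not assumed stable or triangular), $\mathcal Q_{\rm opt}$ is a minimizer for (1) if and only if $\mathcal K_{\rm opt}=F_\ell(\mathcal J_d,\mathcal Q_{\rm opt})$ is a minimizer for (2); (c) for every such $\mathcal Q_{\rm opt}$, $\mathcal Q_{\rm opt}$ is the unique minimizer for (1) if and only if $\mathcal K_{\rm opt}=F_\ell(\mathcal J_d,\mathcal Q_{\rm opt})$ is the unique minimizer for (2); moreover (1) has exactly one minimizer if and only if (2) has exactly one minimizer. -/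

import Mathlib

noncomputable section

namespace TwoPlayer

open Matrix

/-! ### Rational transfer functions -/

/-- Proper real rational functions of the Laplace variable `s = RatFunc.X`. -/
def Rp : Set (RatFunc ℝ) := {r | r.num.natDegree ≤ r.denom.natDegree}

/-- Stable proper real rational functions: proper, with all (complex) poles in the open left
half-plane. -/
def RHinf : Set (RatFunc ℝ) :=
  {r | r ∈ Rp ∧ ∀ z : ℂ, Polynomial.aeval z r.denom = 0 → z.re < 0}

/-- The value at `s = ∞` of a proper rational function. -/
def valueAtInfinity (r : RatFunc ℝ) : ℝ := r.num.coeff r.denom.natDegree / r.denom.leadingCoeff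

/-- Matrices all of whose entries lie in `S`. -/
def MatrixOver (S : Set (RatFunc ℝ)) (a b : Type*) : Set (Matrix a b (RatFunc ℝ)) :=
  {X | ∀ i j, X i j ∈ S}

/-- `Lower S`: block-lower-triangular `2 × 2` block matrices with entries in `S`. -/
def Lower (S : Set (RatFunc ℝ)) (a₁ a₂ b₁ b₂ : ℕ) :
    Set (Matrix (Fin a₁ ⊕ Fin a₂) (Fin b₁ ⊕ Fin b₂) (RatFunc ℝ)) :=
  {X | X ∈ MatrixOver S _ _ ∧ X.toBlocks₁₂ = 0}

/-- A real matrix seen as a constant matrix of rational functions. -/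
def const {a b : Type*} (M : Matrix a b ℝ) : Matrix a b (RatFunc ℝ) := M.map RatFunc.C

/-- The transfer function `D + C (s I - A)⁻¹ B` of the state-space data `(A, B, C, D)`. -/
def transfer {n a b : Type*} [Fintype n] [DecidableEq n]
    (A : Matrix n n ℝ) (B : Matrix n b ℝ) (C : Matrix a n ℝ) (D : Matrix a b ℝ) :
    Matrix a b (RatFunc ℝ) :=
  const D + const C * ((RatFunc.X : RatFunc ℝ) • (1 : Matrix n n (RatFunc ℝ)) - const A)⁻¹ * const B

/-- `(A, B, C, D)` is a minimal realization (of its transfer function): no realization of the same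
transfer function has fewer states. -/
def IsMinimalRealization {n a b : Type*} [Fintype n] [DecidableEq n]
    (A : Matrix n n ℝ) (B : Matrix n b ℝ) (C : Matrix a n ℝ) (D : Matrix a b ℝ) : Prop :=
  ∀ (r : ℕ) (A' : Matrix (Fin r) (Fin r) ℝ) (B' : Matrix (Fin r) b ℝ) (C' : Matrix a (Fin r) ℝ)
    (D' : Matrix a b ℝ), transfer A' B' C' D' = transfer A B C D → Fintype.card n ≤ r

/-- The complex matrix `G(iω)`. -/
def evalImag {a b : Type*} (G : Matrix a b (RatFunc ℝ)) (ω : ℝ) : Matrix a b ℂ :=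
  G.map fun r => r.eval (algebraMap ℝ ℂ) (Complex.I * ω)

/-- `‖G‖₂ = ((1 / 2π) ∫ tr (G(iω)ᴴ G(iω)) dω) ^ (1/2)`, as an extended nonnegative real; for a
stable proper `G` it is finite exactly when `G` is strictly proper. -/
def twoNorm {a b : Type*} [Fintype a] [Fintype b] (G : Matrix a b (RatFunc ℝ)) : ENNReal :=
  (ENNReal.ofReal (1 / (2 * Real.pi)) *
    ∫⁻ ω : ℝ, ENNReal.ofReal (((evalImag G ω)ᴴ * evalImag G ω).trace).re) ^ (1 / 2 : ℝ)

/-! ### Matrices: stability, stabilizability, detectability -/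

/-- All complex eigenvalues have negative real part. -/
def IsHurwitz {n : Type*} [Fintype n] [DecidableEq n] (A : Matrix n n ℝ) : Prop :=
  ∀ z ∈ spectrum ℂ (A.map (algebraMap ℝ ℂ)), z.re < 0

/-- `(A, B)` is stabilizable. -/
def IsStabilizable {n b : Type*} [Fintype n] [DecidableEq n] [Fintype b]
    (A : Matrix n n ℝ) (B : Matrix n b ℝ) : Prop :=
  ∃ K : Matrix b n ℝ, IsHurwitz (A + B * K)

/-- `(C, A)` is detectable. -/
def IsDetectable {n c : Type*} [Fintype n] [DecidableEq n] [Fintype c]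
    (C : Matrix c n ℝ) (A : Matrix n n ℝ) : Prop :=
  ∃ L : Matrix n c ℝ, IsHurwitz (A + L * C)

/-! ### Feedback interconnections -/

section Feedback

variable {z w y u : Type*} [Fintype y] [DecidableEq y] [Fintype u] [DecidableEq u]

/-- Lower linear fractional transformation `P₁₁ + P₁₂ K (I - P₂₂ K)⁻¹ P₂₁`. -/
def lowerLFT (P : Matrix (z ⊕ y) (w ⊕ u) (RatFunc ℝ)) (K : Matrix u y (RatFunc ℝ)) :
    Matrix z w (RatFunc ℝ) :=
  P.toBlocks₁₁ + P.toBlocks₁₂ * K * (1 - P.toBlocks₂₂ * K)⁻¹ * P.toBlocks₂₁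

/-- `I - P₂₂(∞) K(∞)` is nonsingular. -/
def IsWellPosed (P : Matrix (z ⊕ y) (w ⊕ u) (RatFunc ℝ)) (K : Matrix u y (RatFunc ℝ)) : Prop :=
  IsUnit (1 - P.toBlocks₂₂.map valueAtInfinity * K.map valueAtInfinity)

/-- The map `(u₁, u₂) ↦ (y₁, y₂)` of the loop `y₁ = u₁ + P₂₂ y₂`, `y₂ = u₂ + K y₁`. -/
def loopMap (P : Matrix (z ⊕ y) (w ⊕ u) (RatFunc ℝ)) (K : Matrix u y (RatFunc ℝ)) :
    Matrix (y ⊕ u) (y ⊕ u) (RatFunc ℝ) :=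
  (fromBlocks 1 (-P.toBlocks₂₂) (-K) 1)⁻¹

/-- The closed-loop map `(w, u₁, u₂) ↦ (z, y₁, y₂)` determined by
`z = P₁₁ w + P₁₂ y₂`, `y₁ = u₁ + P₂₁ w + P₂₂ y₂`, `y₂ = u₂ + K y₁`:
`u₁` is added to the measurement fed to the controller (the sum is `y₁`), and `u₂` is added to the
controller output fed to the plant (the sum is `y₂`). -/
def closedLoopMap (P : Matrix (z ⊕ y) (w ⊕ u) (RatFunc ℝ)) (K : Matrix u y (RatFunc ℝ)) :
    Matrix (z ⊕ (y ⊕ u)) (w ⊕ (y ⊕ u)) (RatFunc ℝ) :=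
  fromBlocks
    (P.toBlocks₁₁ + fromCols (0 : Matrix z y _) P.toBlocks₁₂ * loopMap P K * fromRows P.toBlocks₂₁ (0 : Matrix u w _))
    (fromCols (0 : Matrix z y _) P.toBlocks₁₂ * loopMap P K)
    (loopMap P K * fromRows P.toBlocks₂₁ (0 : Matrix u w _))
    (loopMap P K)

/-- `K` stabilizes `P`: the interconnection is well-posed, and the closed-loop map
`(w, u₁, u₂) ↦ (z, y₁, y₂)` is stable. -/
def Stabilizes (K : Matrix u y (RatFunc ℝ)) (P : Matrix (z ⊕ y) (w ⊕ u) (RatFunc ℝ)) : Prop :=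
  IsWellPosed P K ∧ closedLoopMap P K ∈ MatrixOver RHinf _ _

end Feedback

/-- `x` minimizes `f` over `s`. -/
def IsMinimizer {α : Type*} (f : α → ENNReal) (s : Set α) (x : α) : Prop :=
  x ∈ s ∧ IsMinOn f s x

/-- `x` is the unique minimizer of `f` over `s`. -/
def IsUniqueMinimizer {α : Type*} (f : α → ENNReal) (s : Set α) (x : α) : Prop :=
  IsMinimizer f s x ∧ ∀ y, IsMinimizer f s y → y = x

/-! ### The two-player plant -/

/-- State-space data of a two-player plant, with states of size `n₁ + n₂`, controls of size
`m₁ + m₂`, measurements of size `k₁ + k₂`, regulated outputs of size `p`, exogenous inputs of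
size `q`. The matrices `A`, `B₂`, `C₂` are block lower triangular and given by their blocks
(`Bij` are the blocks of `B₂`, and `Cij` those of `C₂`). -/
structure Plant (n₁ n₂ m₁ m₂ k₁ k₂ p q : ℕ) where
  A11 : Matrix (Fin n₁) (Fin n₁) ℝ
  A21 : Matrix (Fin n₂) (Fin n₁) ℝ
  A22 : Matrix (Fin n₂) (Fin n₂) ℝ
  B11 : Matrix (Fin n₁) (Fin m₁) ℝ
  B21 : Matrix (Fin n₂) (Fin m₁) ℝ
  B22 : Matrix (Fin n₂) (Fin m₂) ℝ
  C11 : Matrix (Fin k₁) (Fin n₁) ℝ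
  C21 : Matrix (Fin k₂) (Fin n₁) ℝ
  C22 : Matrix (Fin k₂) (Fin n₂) ℝ
  B₁ : Matrix (Fin n₁ ⊕ Fin n₂) (Fin q) ℝ
  C₁ : Matrix (Fin p) (Fin n₁ ⊕ Fin n₂) ℝ
  D₁₂ : Matrix (Fin p) (Fin m₁ ⊕ Fin m₂) ℝ
  D₂₁ : Matrix (Fin k₁ ⊕ Fin k₂) (Fin q) ℝ

namespace Plant

variable {n₁ n₂ m₁ m₂ k₁ k₂ p q : ℕ} (P : Plant n₁ n₂ m₁ m₂ k₁ k₂ p q)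

def A : Matrix (Fin n₁ ⊕ Fin n₂) (Fin n₁ ⊕ Fin n₂) ℝ := fromBlocks P.A11 0 P.A21 P.A22

def B₂ : Matrix (Fin n₁ ⊕ Fin n₂) (Fin m₁ ⊕ Fin m₂) ℝ := fromBlocks P.B11 0 P.B21 P.B22

def C₂ : Matrix (Fin k₁ ⊕ Fin k₂) (Fin n₁ ⊕ Fin n₂) ℝ := fromBlocks P.C11 0 P.C21 P.C22

/-- The input matrix `[B₁ B₂]` of the whole plant. -/
def B : Matrix (Fin n₁ ⊕ Fin n₂) (Fin q ⊕ (Fin m₁ ⊕ Fin m₂)) ℝ := fromCols P.B₁ P.B₂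

/-- The output matrix `[C₁; C₂]` of the whole plant. -/
def C : Matrix (Fin p ⊕ (Fin k₁ ⊕ Fin k₂)) (Fin n₁ ⊕ Fin n₂) ℝ := fromRows P.C₁ P.C₂

/-- The feedthrough matrix `[0 D₁₂; D₂₁ 0]` of the whole plant. -/
def D : Matrix (Fin p ⊕ (Fin k₁ ⊕ Fin k₂)) (Fin q ⊕ (Fin m₁ ⊕ Fin m₂)) ℝ :=
  fromBlocks 0 P.D₁₂ P.D₂₁ 0

/-- The transfer function `(w, u) ↦ (z, y)` of the plant. -/
def tf : Matrix (Fin p ⊕ (Fin k₁ ⊕ Fin k₂)) (Fin q ⊕ (Fin m₁ ⊕ Fin m₂)) (RatFunc ℝ) :=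
  transfer P.A P.B P.C P.D

/-- The admissible controllers of the two-player problem: proper, block lower triangular and
stabilizing. -/
def controllers : Set (Matrix (Fin m₁ ⊕ Fin m₂) (Fin k₁ ⊕ Fin k₂) (RatFunc ℝ)) :=
  {K | K ∈ Lower Rp m₁ m₂ k₁ k₂ ∧ Stabilizes K P.tf}

/-- The cost `‖P₁₁ + P₁₂ K (I - P₂₂ K)⁻¹ P₂₁‖₂` of the two-player problem. -/
def controlCost (K : Matrix (Fin m₁ ⊕ Fin m₂) (Fin k₁ ⊕ Fin k₂) (RatFunc ℝ)) : ENNReal :=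
  twoNorm (lowerLFT P.tf K)

variable (Kd : Matrix (Fin m₁ ⊕ Fin m₂) (Fin n₁ ⊕ Fin n₂) ℝ)
  (Ld : Matrix (Fin n₁ ⊕ Fin n₂) (Fin k₁ ⊕ Fin k₂) ℝ)

/-- The transfer function `J_d` with state-space data
`(A + B₂ Kd + Ld C₂, [-Ld B₂], [Kd; -C₂], [0 I; I 0])`. -/
def Jd : Matrix ((Fin m₁ ⊕ Fin m₂) ⊕ (Fin k₁ ⊕ Fin k₂)) ((Fin k₁ ⊕ Fin k₂) ⊕ (Fin m₁ ⊕ Fin m₂))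
    (RatFunc ℝ) :=
  transfer (P.A + P.B₂ * Kd + Ld * P.C₂) (fromCols (-Ld) P.B₂) (fromRows Kd (-P.C₂))
    (fromBlocks 0 1 1 0)

/-- The transfer function `T = [T₁₁ T₁₂; T₂₁ 0]` of the model-matching problem. -/
def T : Matrix (Fin p ⊕ (Fin k₁ ⊕ Fin k₂)) (Fin q ⊕ (Fin m₁ ⊕ Fin m₂)) (RatFunc ℝ) :=
  transfer
    (fromBlocks (P.A + P.B₂ * Kd) (-(P.B₂ * Kd)) 0 (P.A + Ld * P.C₂))
    (fromBlocks P.B₁ P.B₂ (P.B₁ + Ld * P.D₂₁) 0)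
    (fromBlocks (P.C₁ + P.D₁₂ * Kd) (-(P.D₁₂ * Kd)) 0 P.C₂)
    (fromBlocks 0 P.D₁₂ P.D₂₁ 0)

/-- The cost `‖T₁₁ + T₁₂ Q T₂₁‖₂` of the model-matching problem. -/
def matchingCost (Q : Matrix (Fin m₁ ⊕ Fin m₂) (Fin k₁ ⊕ Fin k₂) (RatFunc ℝ)) : ENNReal :=
  twoNorm ((P.T Kd Ld).toBlocks₁₁ + (P.T Kd Ld).toBlocks₁₂ * Q * (P.T Kd Ld).toBlocks₂₁)

end Plant

end TwoPlayer

end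

open TwoPlayer

/-!
# The structured Youla parameterization of a two-player plant

Write `G` for the transfer function from controls to measurements. The gains `Kd` and `Ld` make
`A + B₂ Kd` and `A + Ld C₂` Hurwitz, since both are block triangular with Hurwitz diagonal blocks.
They yield a doubly coprime factorization `G = N M⁻¹ = M̃⁻¹ Ñ` over the stable proper rational
functions, with Bezout factors `X`, `Y`, `X̃`, `Ỹ` (`Plant.rightM` and so on for the letters without
tilde, `Plant.leftM` and so on for those with one); all identities between these factors follow from
the resolvent identity for `(s I - A)⁻¹`, `(s I - A - B₂ Kd)⁻¹` and `(s I - A - Ld C₂)⁻¹`.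

In these terms `F_ℓ(J_d, Q) = (Y + M Q) (X + N Q)⁻¹` (`Plant.lowerLFT_Jd_mul`), where the inverse
exists for every proper `Q` because `N` vanishes at infinity and `X` is the identity there. The loop
map of this controller is affine in `Q` with stable coefficients
(`Plant.loopMap_lowerLFT_Jd`), and the unstable plant blocks `P₁₂` and `P₂₁` enter the closed loop
only through `P₁₂ M = T₁₂` and `M̃ P₂₁ = T₂₁`; hence a stable `Q` gives a stabilizing controller
(`Plant.closedLoopMap_stable`), whose closed-loop map from `w` to `z` is `T₁₁ + T₁₂ Q T₂₁`
(`Plant.lowerLFT_tf_lowerLFT_Jd`). Conversely `K = F_ℓ(J_d, Q)` means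
`(M - K N) Q = K X - Y`, where `M - K N` is invertible for proper `K`. So `Q` is determined by `K`
(`Plant.injOn_lowerLFT_Jd`), and it is stable as soon as the loop map of `K` is
(`Plant.exists_stable_parameter`). All factors are block lower triangular, so both directions
preserve this structure (`Plant.image_lowerLFT_Jd`).

Thus `F_ℓ(J_d, ·)` is injective on the proper matrices, maps the feasible set of the model-matching
problem onto the set of admissible controllers and matches the two costs, which transports
minimizers and their uniqueness.
-/

noncomputable section

namespace TwoPlayer

open Matrix

/-! ### Proper and stable rational functions -/

/-- The valuation of the rational functions at infinity, in multiplicative notation. -/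
def infinityValuation : Valuation (RatFunc ℝ) (WithZero (Multiplicative ℤ)) :=
  letI := Classical.decEq (RatFunc ℝ)
  RatFunc.inftyValuation ℝ

theorem infinityValuation_eq {r : RatFunc ℝ} (hr : r ≠ 0) :
    infinityValuation r = WithZero.exp r.intDegree := by
  rw [infinityValuation, RatFunc.inftyValuation_apply, RatFunc.inftyValuationDef, if_neg hr]

theorem mem_Rp_iff {r : RatFunc ℝ} : r ∈ Rp ↔ infinityValuation r ≤ 1 := by
  by_cases hr : r = 0
  · simp [hr, Rp]
  · rw [infinityValuation_eq hr, ← WithZero.exp_zero, WithZero.exp_le_exp, RatFunc.intDegree, Rp,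
      Set.mem_ofPred_eq]
    lia

/-- The proper rational functions form the valuation ring of the place at infinity. -/
def properSubring : Subring (RatFunc ℝ) :=
  infinityValuation.integer.copy Rp (Set.ext fun _ => mem_Rp_iff)

/-- The rational functions that vanish at infinity. -/
def StrictlyProper : Set (RatFunc ℝ) := {r | infinityValuation r < 1}

theorem valueAtInfinity_eq_zero {r : RatFunc ℝ} (hr : r ∈ StrictlyProper) :
    valueAtInfinity r = 0 := by
  by_cases h0 : r = 0
  · simp [h0, valueAtInfinity]
  · rw [StrictlyProper, Set.mem_ofPred_eq, infinityValuation_eq h0, ← WithZero.exp_zero,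
      WithZero.exp_lt_exp, RatFunc.intDegree] at hr
    rw [valueAtInfinity, Polynomial.coeff_eq_zero_of_natDegree_lt (by lia), zero_div]

theorem mem_RHinf_of_denom_dvd {r : RatFunc ℝ} {f : Polynomial ℝ} (hr : r ∈ Rp)
    (hd : r.denom ∣ f) (hf : ∀ z : ℂ, Polynomial.aeval z f = 0 → z.re < 0) : r ∈ RHinf :=
  ⟨hr, fun z hz => hf z (Polynomial.aeval_eq_zero_of_dvd_aeval_eq_zero hd hz)⟩

theorem C_mem_RHinf (c : ℝ) : RatFunc.C c ∈ RHinf := by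
  constructor
  · simp [Rp, RatFunc.num_C, RatFunc.denom_C]
  · simp [RatFunc.denom_C]

theorem aeval_denom_mul_denom {r s : RatFunc ℝ} (hr : r ∈ RHinf) (hs : s ∈ RHinf) (z : ℂ)
    (hz : Polynomial.aeval z (r.denom * s.denom) = 0) : z.re < 0 := by
  rw [map_mul, mul_eq_zero] at hz
  exact hz.elim (hr.2 z) (hs.2 z)

/-- The stable proper rational functions form a ring, because the denominator of a sum or of a
product divides the product of the denominators. -/
def stableSubring : Subring (RatFunc ℝ) where
  carrier := RHinf
  zero_mem' := by simpa using C_mem_RHinf 0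
  one_mem' := by simpa using C_mem_RHinf 1
  add_mem' {r s} hr hs := mem_RHinf_of_denom_dvd (properSubring.add_mem hr.1 hs.1)
    (RatFunc.denom_add_dvd r s) (aeval_denom_mul_denom hr hs)
  mul_mem' {r s} hr hs := mem_RHinf_of_denom_dvd (properSubring.mul_mem hr.1 hs.1)
    (RatFunc.denom_mul_dvd r s) (aeval_denom_mul_denom hr hs)
  neg_mem' {r} hr := by
    have hm : RatFunc.C (-1) * r = -r := by simp
    rw [← hm]
    exact mem_RHinf_of_denom_dvd (properSubring.mul_mem (C_mem_RHinf (-1)).1 hr.1)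
      (RatFunc.denom_mul_dvd _ r) (aeval_denom_mul_denom (C_mem_RHinf (-1)) hr)

/-! ### Matrices over a subring -/

section MatrixOver

variable {a b c : Type*} {S : Subring (RatFunc ℝ)}

theorem MatrixOver.one [DecidableEq a] : (1 : Matrix a a (RatFunc ℝ)) ∈ MatrixOver S a a := by
  intro i j
  rw [Matrix.one_apply]
  split_ifs
  exacts [S.one_mem, S.zero_mem]

theorem MatrixOver.add {X Y : Matrix a b (RatFunc ℝ)} (hX : X ∈ MatrixOver S a b)
    (hY : Y ∈ MatrixOver S a b) : X + Y ∈ MatrixOver S a b :=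
  fun i j => S.add_mem (hX i j) (hY i j)

theorem MatrixOver.sub {X Y : Matrix a b (RatFunc ℝ)} (hX : X ∈ MatrixOver S a b)
    (hY : Y ∈ MatrixOver S a b) : X - Y ∈ MatrixOver S a b :=
  fun i j => S.sub_mem (hX i j) (hY i j)

theorem MatrixOver.mul [Fintype b] {X : Matrix a b (RatFunc ℝ)} {Y : Matrix b c (RatFunc ℝ)}
    (hX : X ∈ MatrixOver S a b) (hY : Y ∈ MatrixOver S b c) : X * Y ∈ MatrixOver S a c :=
  fun i j => S.sum_mem fun k _ => S.mul_mem (hX i k) (hY k j)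

theorem MatrixOver.stable_const (M : Matrix a b ℝ) : const M ∈ MatrixOver stableSubring a b :=
  fun _ _ => C_mem_RHinf _

theorem MatrixOver.proper_of_stable {X : Matrix a b (RatFunc ℝ)}
    (hX : X ∈ MatrixOver stableSubring a b) : X ∈ MatrixOver properSubring a b :=
  fun i j => (hX i j).1

theorem MatrixOver.proper_const (M : Matrix a b ℝ) : const M ∈ MatrixOver properSubring a b :=
  MatrixOver.proper_of_stable (.stable_const M)

theorem MatrixOver.fromBlocks {d : Type*} {X : Matrix a c (RatFunc ℝ)} {Y : Matrix a d (RatFunc ℝ)}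
    {Z : Matrix b c (RatFunc ℝ)} {W : Matrix b d (RatFunc ℝ)} (hX : X ∈ MatrixOver S a c)
    (hY : Y ∈ MatrixOver S a d) (hZ : Z ∈ MatrixOver S b c) (hW : W ∈ MatrixOver S b d) :
    Matrix.fromBlocks X Y Z W ∈ MatrixOver S (a ⊕ b) (c ⊕ d) := by
  rintro (i | i) (j | j)
  exacts [hX i j, hY i j, hZ i j, hW i j]

theorem MatrixOver.fromRows {X : Matrix a c (RatFunc ℝ)} {Y : Matrix b c (RatFunc ℝ)}
    (hX : X ∈ MatrixOver S a c) (hY : Y ∈ MatrixOver S b c) :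
    Matrix.fromRows X Y ∈ MatrixOver S (a ⊕ b) c := by
  rintro (i | i) j
  exacts [hX i j, hY i j]

theorem MatrixOver.fromCols {X : Matrix a b (RatFunc ℝ)} {Y : Matrix a c (RatFunc ℝ)}
    (hX : X ∈ MatrixOver S a b) (hY : Y ∈ MatrixOver S a c) :
    Matrix.fromCols X Y ∈ MatrixOver S a (b ⊕ c) := by
  rintro i (j | j)
  exacts [hX i j, hY i j]

theorem MatrixOver.strictlyProper_add {X Y : Matrix a b (RatFunc ℝ)}
    (hX : X ∈ MatrixOver StrictlyProper a b) (hY : Y ∈ MatrixOver StrictlyProper a b) :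
    X + Y ∈ MatrixOver StrictlyProper a b :=
  fun i j => infinityValuation.map_add_lt (hX i j) (hY i j)

theorem MatrixOver.strictlyProper_neg {X : Matrix a b (RatFunc ℝ)}
    (hX : X ∈ MatrixOver StrictlyProper a b) : -X ∈ MatrixOver StrictlyProper a b :=
  fun i j => (infinityValuation.map_neg (X i j)).trans_lt (hX i j)

theorem MatrixOver.strictlyProper_mul [Fintype b] {X : Matrix a b (RatFunc ℝ)}
    {Y : Matrix b c (RatFunc ℝ)} (hX : X ∈ MatrixOver StrictlyProper a b)
    (hY : Y ∈ MatrixOver properSubring b c) : X * Y ∈ MatrixOver StrictlyProper a c := by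
  intro i j
  refine Valuation.map_sum_lt infinityValuation one_ne_zero fun k _ => ?_
  rw [map_mul]
  exact mul_lt_one_of_lt_of_le (hX i k) (mem_Rp_iff.1 (hY k j))

theorem MatrixOver.mul_strictlyProper [Fintype b] {X : Matrix a b (RatFunc ℝ)}
    {Y : Matrix b c (RatFunc ℝ)} (hX : X ∈ MatrixOver properSubring a b)
    (hY : Y ∈ MatrixOver StrictlyProper b c) : X * Y ∈ MatrixOver StrictlyProper a c := by
  intro i j
  refine Valuation.map_sum_lt infinityValuation one_ne_zero fun k _ => ?_
  rw [map_mul, mul_comm]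
  exact mul_lt_one_of_lt_of_le (hY k j) (mem_Rp_iff.1 (hX i k))

/-- Proper rational functions form a local ring whose maximal ideal consists of the strictly proper
ones; so `det (1 + E)`, congruent to `1` modulo that ideal, is a unit of the ring. -/
theorem MatrixOver.exists_inverse_one_add [Fintype a] [DecidableEq a] {E : Matrix a a (RatFunc ℝ)}
    (hE : E ∈ MatrixOver StrictlyProper a a) :
    ∃ W ∈ MatrixOver properSubring a a, (1 + E) * W = 1 := by
  let O := infinityValuation.valuationSubring
  let E' : Matrix a a O := of fun i j =>
    ⟨E i j, (Valuation.mem_valuationSubring_iff _ _).2 (le_of_lt (hE i j))⟩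
  have hres : (IsLocalRing.residue O).mapMatrix E' = 0 := by
    ext i j
    refine (IsLocalRing.residue_eq_zero_iff _).2 ((IsLocalRing.mem_maximalIdeal _).2 ?_)
    rintro hu
    obtain ⟨x, hx⟩ := hu.exists_right_inv
    have h1 : infinityValuation (E i j) * infinityValuation (x : RatFunc ℝ) = 1 := by
      rw [← map_mul, ← map_one infinityValuation]
      exact congrArg _ (congrArg Subtype.val hx)
    exact (mul_lt_one_of_lt_of_le (hE i j) x.2).ne h1
  have hdet : IsUnit (1 + E').det := by
    refine IsUnit.of_map (IsLocalRing.residue O) _ ?_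
    rw [RingHom.map_det, map_add, map_one, hres, add_zero, det_one]
    exact isUnit_one
  refine ⟨O.subtype.mapMatrix (1 + E')⁻¹, fun i j => mem_Rp_iff.2 ((1 + E')⁻¹ i j).2, ?_⟩
  have hmap : O.subtype.mapMatrix (1 + E') = 1 + E := by
    rw [map_add, map_one]
    rfl
  rw [← hmap, ← map_mul, mul_nonsing_inv _ hdet, map_one]

theorem MatrixOver.isUnit_one_add [Fintype a] [DecidableEq a] {E : Matrix a a (RatFunc ℝ)}
    (hE : E ∈ MatrixOver StrictlyProper a a) : IsUnit (1 + E) := by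
  obtain ⟨W, -, hW⟩ := MatrixOver.exists_inverse_one_add hE
  exact IsUnit.of_mul_eq_one W hW

theorem MatrixOver.inv_one_add [Fintype a] [DecidableEq a] {E : Matrix a a (RatFunc ℝ)}
    (hE : E ∈ MatrixOver StrictlyProper a a) : (1 + E)⁻¹ ∈ MatrixOver properSubring a a := by
  obtain ⟨W, hWp, hW⟩ := MatrixOver.exists_inverse_one_add hE
  rwa [inv_eq_right_inv hW]

end MatrixOver

/-! ### Constant matrices -/

section Const

variable {a b c d : Type*}

theorem const_zero : const (0 : Matrix a b ℝ) = 0 := by ext; simp [const]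

theorem const_one [DecidableEq a] : const (1 : Matrix a a ℝ) = 1 :=
  Matrix.map_one _ (map_zero _) (map_one _)

theorem const_add (M N : Matrix a b ℝ) : const (M + N) = const M + const N := by
  ext; simp [const]

theorem const_neg (M : Matrix a b ℝ) : const (-M) = -const M := by ext; simp [const]

theorem const_mul [Fintype b] (M : Matrix a b ℝ) (N : Matrix b c ℝ) :
    const (M * N) = const M * const N := Matrix.map_mul

theorem const_fromRows (M : Matrix a c ℝ) (N : Matrix b c ℝ) :
    const (fromRows M N) = fromRows (const M) (const N) := by
  ext (i | i) j <;> rfl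

theorem const_fromCols (M : Matrix a b ℝ) (N : Matrix a c ℝ) :
    const (fromCols M N) = fromCols (const M) (const N) := by
  ext i (j | j) <;> rfl

theorem const_fromBlocks (M : Matrix a c ℝ) (N : Matrix a d ℝ) (M' : Matrix b c ℝ)
    (N' : Matrix b d ℝ) :
    const (fromBlocks M N M' N') = fromBlocks (const M) (const N) (const M') (const N') :=
  fromBlocks_map M N M' N' _

end Const

/-! ### Resolvents and transfer functions -/

section Resolvent

variable {n a b c d : Type*} [Fintype n] [DecidableEq n]

/-- The resolvent `(s I - A)⁻¹` of a real matrix, as a matrix of rational functions. -/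
def resolventMatrix (A : Matrix n n ℝ) : Matrix n n (RatFunc ℝ) :=
  ((RatFunc.X : RatFunc ℝ) • (1 : Matrix n n (RatFunc ℝ)) - const A)⁻¹

theorem exists_strictlyProper_inverse (A : Matrix n n ℝ) :
    ∃ R ∈ MatrixOver StrictlyProper n n,
      ((RatFunc.X : RatFunc ℝ) • (1 : Matrix n n (RatFunc ℝ)) - const A) * R = 1 := by
  have hX : infinityValuation (RatFunc.X)⁻¹ < 1 := by
    rw [map_inv₀, infinityValuation_eq RatFunc.X_ne_zero, RatFunc.intDegree_X,
      ← WithZero.exp_neg, ← WithZero.exp_zero, WithZero.exp_lt_exp]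
    lia
  -- factor out `s`: the matrix `1 - s⁻¹ A` has a proper inverse
  have hE : -((RatFunc.X : RatFunc ℝ)⁻¹ • const A) ∈ MatrixOver StrictlyProper n n := by
    refine MatrixOver.strictlyProper_neg fun i j => ?_
    rw [Matrix.smul_apply, smul_eq_mul, StrictlyProper, Set.mem_ofPred_eq, map_mul]
    exact mul_lt_one_of_lt_of_le hX (mem_Rp_iff.1 (MatrixOver.proper_const A i j))
  obtain ⟨W, hWp, hW⟩ := MatrixOver.exists_inverse_one_add hE
  refine ⟨(RatFunc.X : RatFunc ℝ)⁻¹ • W, fun i j => ?_, ?_⟩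
  · rw [Matrix.smul_apply, smul_eq_mul, StrictlyProper, Set.mem_ofPred_eq, map_mul]
    exact mul_lt_one_of_lt_of_le hX (mem_Rp_iff.1 (hWp i j))
  · rw [Matrix.mul_smul, ← Matrix.smul_mul, smul_sub, smul_smul, inv_mul_cancel₀ RatFunc.X_ne_zero,
      one_smul, sub_eq_add_neg, hW]

theorem isUnit_X_smul_one_sub_const (A : Matrix n n ℝ) :
    IsUnit ((RatFunc.X : RatFunc ℝ) • (1 : Matrix n n (RatFunc ℝ)) - const A) := by
  obtain ⟨R, -, hR⟩ := exists_strictlyProper_inverse A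
  exact IsUnit.of_mul_eq_one R hR

theorem resolventMatrix_strictlyProper (A : Matrix n n ℝ) :
    resolventMatrix A ∈ MatrixOver StrictlyProper n n := by
  obtain ⟨R, hRp, hR⟩ := exists_strictlyProper_inverse A
  rwa [resolventMatrix, inv_eq_right_inv hR]

theorem IsHurwitz.re_neg_of_aeval_charpoly {A : Matrix n n ℝ} (hA : IsHurwitz A) (z : ℂ)
    (hz : Polynomial.aeval z A.charpoly = 0) : z.re < 0 := by
  refine hA z (Matrix.mem_spectrum_iff_isRoot_charpoly.2 ?_)
  rwa [charpoly_map, Polynomial.IsRoot, Polynomial.eval_map_algebraMap]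

/-- By Cramer's rule the denominators of the resolvent divide the characteristic polynomial. -/
theorem resolventMatrix_stable {A : Matrix n n ℝ} (hA : IsHurwitz A) :
    resolventMatrix A ∈ MatrixOver stableSubring n n := by
  intro i j
  refine mem_RHinf_of_denom_dvd (f := A.charpoly)
    (mem_Rp_iff.2 (resolventMatrix_strictlyProper A i j).le) ?_ hA.re_neg_of_aeval_charpoly
  have hchar : (RatFunc.X : RatFunc ℝ) • (1 : Matrix n n (RatFunc ℝ)) - const A =
      (algebraMap (Polynomial ℝ) (RatFunc ℝ)).mapMatrix A.charmatrix := by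
    ext i j
    by_cases hij : i = j
    · subst hij; simp [const]
    · simp [const, hij]
  have hentry : resolventMatrix A i j =
      algebraMap (Polynomial ℝ) (RatFunc ℝ) (A.charmatrix.adjugate i j) /
        algebraMap (Polynomial ℝ) (RatFunc ℝ) A.charpoly := by
    rw [resolventMatrix, hchar, inv_def, ← RingHom.map_det, ← RingHom.map_adjugate,
      Matrix.smul_apply, smul_eq_mul, Ring.inverse_eq_inv, div_eq_inv_mul]
    rfl
  rw [hentry]
  exact RatFunc.denom_div_dvd _ _

theorem transfer_eq (A : Matrix n n ℝ) (B : Matrix n b ℝ) (C : Matrix a n ℝ) (D : Matrix a b ℝ) :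
    transfer A B C D = const D + const C * (resolventMatrix A * const B) := by
  rw [transfer, resolventMatrix, Matrix.mul_assoc]

theorem transfer_stable {A : Matrix n n ℝ} (hA : IsHurwitz A) (B : Matrix n b ℝ)
    (C : Matrix a n ℝ) (D : Matrix a b ℝ) : transfer A B C D ∈ MatrixOver stableSubring a b := by
  rw [transfer_eq]
  exact .add (.stable_const D) (.mul (.stable_const C)
    (.mul (resolventMatrix_stable hA) (.stable_const B)))

theorem transfer_zero_strictlyProper (A : Matrix n n ℝ) (B : Matrix n b ℝ) (C : Matrix a n ℝ) :
    transfer A B C 0 ∈ MatrixOver StrictlyProper a b := by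
  rw [transfer_eq, const_zero, zero_add]
  exact .mul_strictlyProper (.proper_const C)
    (.strictlyProper_mul (resolventMatrix_strictlyProper A) (.proper_const B))

theorem transfer_one [DecidableEq a] (A : Matrix n n ℝ) (B : Matrix n a ℝ) (C : Matrix a n ℝ) :
    transfer A B C 1 = 1 + transfer A B C 0 := by
  rw [transfer_eq, transfer_eq, const_one, const_zero, zero_add]

theorem transfer_fromBlocks (A : Matrix n n ℝ) (B : Matrix n c ℝ) (B' : Matrix n d ℝ)
    (C : Matrix a n ℝ) (C' : Matrix b n ℝ) (D₁₁ : Matrix a c ℝ) (D₁₂ : Matrix a d ℝ)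
    (D₂₁ : Matrix b c ℝ) (D₂₂ : Matrix b d ℝ) :
    transfer A (fromCols B B') (fromRows C C') (fromBlocks D₁₁ D₁₂ D₂₁ D₂₂) =
      fromBlocks (transfer A B C D₁₁) (transfer A B' C D₁₂) (transfer A B C' D₂₁)
        (transfer A B' C' D₂₂) := by
  simp only [transfer_eq, const_fromBlocks, const_fromCols, const_fromRows,
    mul_fromCols, fromRows_mul, fromCols_fromRows_eq_fromBlocks, fromBlocks_add]

theorem resolventMatrix_mul_sub_mul (A A' : Matrix n n ℝ) :
    resolventMatrix A' * (const A' - const A) * resolventMatrix A =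
      resolventMatrix A' - resolventMatrix A := by
  have h := (isUnit_iff_isUnit_det _).1 (isUnit_X_smul_one_sub_const A)
  have h' := (isUnit_iff_isUnit_det _).1 (isUnit_X_smul_one_sub_const A')
  have hsub : const A' - const A =
      ((RatFunc.X : RatFunc ℝ) • (1 : Matrix n n (RatFunc ℝ)) - const A) -
      ((RatFunc.X : RatFunc ℝ) • (1 : Matrix n n (RatFunc ℝ)) - const A') := by abel
  rw [hsub, Matrix.mul_sub, Matrix.sub_mul, resolventMatrix, resolventMatrix,
    nonsing_inv_mul _ h', Matrix.mul_assoc, mul_nonsing_inv _ h, Matrix.mul_one, Matrix.one_mul]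

variable [Fintype a] [Fintype b]

/-- The resolvent identity for `A + L C` and `A`, in the form that rewrites right-nested
products. -/
theorem resolventMatrix_add_mul_resolventMatrix (A : Matrix n n ℝ) (L : Matrix n a ℝ)
    (C : Matrix a n ℝ) (W : Matrix n d (RatFunc ℝ)) :
    resolventMatrix (A + L * C) * (const L * (const C * (resolventMatrix A * W))) =
      resolventMatrix (A + L * C) * W - resolventMatrix A * W := by
  have h := resolventMatrix_mul_sub_mul A (A + L * C)
  rw [const_add, const_mul, add_sub_cancel_left] at h
  rw [← Matrix.sub_mul, ← h]
  simp only [Matrix.mul_assoc]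

theorem resolventMatrix_mul_resolventMatrix_add (A : Matrix n n ℝ) (L : Matrix n a ℝ)
    (C : Matrix a n ℝ) (W : Matrix n d (RatFunc ℝ)) :
    resolventMatrix A * (const L * (const C * (resolventMatrix (A + L * C) * W))) =
      resolventMatrix (A + L * C) * W - resolventMatrix A * W := by
  have h := resolventMatrix_mul_sub_mul (A + L * C) A
  rw [const_add, const_mul, sub_add_cancel_left] at h
  rw [← Matrix.sub_mul, ← neg_sub (resolventMatrix A), ← h]
  simp only [Matrix.mul_assoc, Matrix.neg_mul, Matrix.mul_neg, neg_neg]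

/-- The resolvent identity for two different perturbations `A + B K` and `A + L C` of `A`. -/
theorem resolventMatrix_add_mul_resolventMatrix_add (A : Matrix n n ℝ) (B : Matrix n b ℝ)
    (K : Matrix b n ℝ) (L : Matrix n a ℝ) (C : Matrix a n ℝ) (W : Matrix n d (RatFunc ℝ)) :
    resolventMatrix (A + B * K) * (const B * (const K * (resolventMatrix (A + L * C) * W))) =
      resolventMatrix (A + B * K) * W - resolventMatrix (A + L * C) * W +
      resolventMatrix (A + B * K) * (const L * (const C * (resolventMatrix (A + L * C) * W))) := by
  have h := resolventMatrix_mul_sub_mul (A + L * C) (A + B * K)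
  rw [const_add, const_add, const_mul, const_mul, add_sub_add_left_eq_sub] at h
  rw [← Matrix.sub_mul, ← h]
  simp only [Matrix.mul_assoc, Matrix.sub_mul, Matrix.mul_sub]
  abel

theorem resolventMatrix_fromBlocks_zero₂₁ {n' : Type*} [Fintype n'] [DecidableEq n']
    (A : Matrix n n ℝ) (E : Matrix n n' ℝ) (A' : Matrix n' n' ℝ) :
    resolventMatrix (fromBlocks A E 0 A') =
      fromBlocks (resolventMatrix A) (resolventMatrix A * const E * resolventMatrix A') 0
        (resolventMatrix A') := by
  have hblock : (RatFunc.X : RatFunc ℝ) • (1 : Matrix (n ⊕ n') (n ⊕ n') (RatFunc ℝ)) -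
      const (fromBlocks A E 0 A') =
      fromBlocks ((RatFunc.X : RatFunc ℝ) • (1 : Matrix n n (RatFunc ℝ)) - const A) (-const E) 0
        ((RatFunc.X : RatFunc ℝ) • (1 : Matrix n' n' (RatFunc ℝ)) - const A') := by
    rw [const_fromBlocks, const_zero, ← fromBlocks_one, fromBlocks_smul, sub_eq_add_neg,
      fromBlocks_neg, fromBlocks_add]
    simp [sub_eq_add_neg]
  rw [resolventMatrix, hblock, inv_fromBlocks_zero₂₁_of_isUnit_iff _ _ _
    (iff_of_true (isUnit_X_smul_one_sub_const A) (isUnit_X_smul_one_sub_const A'))]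
  simp [resolventMatrix]

theorem IsHurwitz.fromBlocks_zero₁₂ {n' : Type*} [Fintype n'] [DecidableEq n']
    {A : Matrix n n ℝ} {A' : Matrix n' n' ℝ} (hA : IsHurwitz A) (hA' : IsHurwitz A')
    (E : Matrix n' n ℝ) : IsHurwitz (fromBlocks A 0 E A') := by
  intro z hz
  rw [Matrix.mem_spectrum_iff_isRoot_charpoly, charpoly_map, Matrix.charpoly_fromBlocks_zero₁₂,
    Polynomial.IsRoot, Polynomial.eval_map_algebraMap, map_mul, mul_eq_zero] at hz
  exact hz.elim (hA.re_neg_of_aeval_charpoly z) (hA'.re_neg_of_aeval_charpoly z)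

end Resolvent

/-! ### Block lower triangular matrices -/

section BlockLower

variable {a₁ a₂ b₁ b₂ c₁ c₂ : Type*}

theorem toBlocks₁₂_mul_eq_zero [Fintype b₁] [Fintype b₂]
    {X : Matrix (a₁ ⊕ a₂) (b₁ ⊕ b₂) (RatFunc ℝ)} {Y : Matrix (b₁ ⊕ b₂) (c₁ ⊕ c₂) (RatFunc ℝ)}
    (hX : X.toBlocks₁₂ = 0) (hY : Y.toBlocks₁₂ = 0) :
    (X * Y).toBlocks₁₂ = 0 := by
  rw [← fromBlocks_toBlocks X, ← fromBlocks_toBlocks Y, fromBlocks_multiply, hX, hY]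
  simp

theorem toBlocks₁₂_add_eq_zero {X Y : Matrix (a₁ ⊕ a₂) (b₁ ⊕ b₂) (RatFunc ℝ)}
    (hX : X.toBlocks₁₂ = 0) (hY : Y.toBlocks₁₂ = 0) : (X + Y).toBlocks₁₂ = 0 := by
  rw [← fromBlocks_toBlocks X, ← fromBlocks_toBlocks Y, fromBlocks_add, hX, hY]
  simp

theorem toBlocks₁₂_neg_eq_zero {X : Matrix (a₁ ⊕ a₂) (b₁ ⊕ b₂) (RatFunc ℝ)}
    (hX : X.toBlocks₁₂ = 0) : (-X).toBlocks₁₂ = 0 := by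
  rw [← fromBlocks_toBlocks X, fromBlocks_neg, hX]
  simp

theorem toBlocks₁₂_sub_eq_zero {X Y : Matrix (a₁ ⊕ a₂) (b₁ ⊕ b₂) (RatFunc ℝ)}
    (hX : X.toBlocks₁₂ = 0) (hY : Y.toBlocks₁₂ = 0) : (X - Y).toBlocks₁₂ = 0 := by
  rw [sub_eq_add_neg]
  exact toBlocks₁₂_add_eq_zero hX (toBlocks₁₂_neg_eq_zero hY)

theorem toBlocks₁₂_inv_eq_zero [Fintype a₁] [Fintype a₂] [DecidableEq a₁] [DecidableEq a₂]
    {X : Matrix (a₁ ⊕ a₂) (a₁ ⊕ a₂) (RatFunc ℝ)} (hX : X.toBlocks₁₂ = 0) (hu : IsUnit X) :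
    X⁻¹.toBlocks₁₂ = 0 := by
  rw [← fromBlocks_toBlocks X, hX] at hu ⊢
  have h := isUnit_fromBlocks_zero₁₂.1 hu
  rw [inv_fromBlocks_zero₁₂_of_isUnit_iff _ _ _ (iff_of_true h.1 h.2), toBlocks_fromBlocks₁₂]

theorem toBlocks₁₂_const_eq_zero {X : Matrix (a₁ ⊕ a₂) (b₁ ⊕ b₂) ℝ} (hX : X.toBlocks₁₂ = 0) :
    (const X).toBlocks₁₂ = 0 := by
  rw [← fromBlocks_toBlocks X, hX, const_fromBlocks, toBlocks_fromBlocks₁₂, const_zero]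

theorem toBlocks₁₂_transfer_eq_zero [Fintype a₁] [Fintype a₂] [DecidableEq a₁] [DecidableEq a₂]
    {A : Matrix (a₁ ⊕ a₂) (a₁ ⊕ a₂) ℝ} {B : Matrix (a₁ ⊕ a₂) (b₁ ⊕ b₂) ℝ}
    {C : Matrix (c₁ ⊕ c₂) (a₁ ⊕ a₂) ℝ} {D : Matrix (c₁ ⊕ c₂) (b₁ ⊕ b₂) ℝ}
    (hA : A.toBlocks₁₂ = 0) (hB : B.toBlocks₁₂ = 0) (hC : C.toBlocks₁₂ = 0)
    (hD : D.toBlocks₁₂ = 0) : (transfer A B C D).toBlocks₁₂ = 0 := by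
  have hX : ((RatFunc.X : RatFunc ℝ) •
      (1 : Matrix (a₁ ⊕ a₂) (a₁ ⊕ a₂) (RatFunc ℝ))).toBlocks₁₂ = 0 := by
    rw [← fromBlocks_one, fromBlocks_smul, toBlocks_fromBlocks₁₂, smul_zero]
  rw [transfer_eq]
  exact toBlocks₁₂_add_eq_zero (toBlocks₁₂_const_eq_zero hD)
    (toBlocks₁₂_mul_eq_zero (toBlocks₁₂_const_eq_zero hC)
      (toBlocks₁₂_mul_eq_zero (toBlocks₁₂_inv_eq_zero
        (toBlocks₁₂_sub_eq_zero hX (toBlocks₁₂_const_eq_zero hA)) (isUnit_X_smul_one_sub_const A))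
        (toBlocks₁₂_const_eq_zero hB)))

end BlockLower

/-! ### Doubly coprime factorization -/

namespace Plant

variable {n₁ n₂ m₁ m₂ k₁ k₂ p q : ℕ} (P : Plant n₁ n₂ m₁ m₂ k₁ k₂ p q)
  (Kd : Matrix (Fin m₁ ⊕ Fin m₂) (Fin n₁ ⊕ Fin n₂) ℝ)
  (Ld : Matrix (Fin n₁ ⊕ Fin n₂) (Fin k₁ ⊕ Fin k₂) ℝ)

/-- The transfer function `u ↦ y` of the plant. -/
def G : Matrix (Fin k₁ ⊕ Fin k₂) (Fin m₁ ⊕ Fin m₂) (RatFunc ℝ) := transfer P.A P.B₂ P.C₂ 0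

/-- Denominator of the right factorization `G = N M⁻¹`. -/
def rightM : Matrix (Fin m₁ ⊕ Fin m₂) (Fin m₁ ⊕ Fin m₂) (RatFunc ℝ) :=
  transfer (P.A + P.B₂ * Kd) P.B₂ Kd 1

/-- Numerator of the right factorization `G = N M⁻¹`. -/
def rightN : Matrix (Fin k₁ ⊕ Fin k₂) (Fin m₁ ⊕ Fin m₂) (RatFunc ℝ) :=
  transfer (P.A + P.B₂ * Kd) P.B₂ P.C₂ 0

/-- Numerator of the right factorization `Y X⁻¹` of the observer-based controller. -/
def rightY : Matrix (Fin m₁ ⊕ Fin m₂) (Fin k₁ ⊕ Fin k₂) (RatFunc ℝ) :=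
  transfer (P.A + P.B₂ * Kd) (-Ld) Kd 0

/-- Denominator of the right factorization `Y X⁻¹` of the observer-based controller. -/
def rightX : Matrix (Fin k₁ ⊕ Fin k₂) (Fin k₁ ⊕ Fin k₂) (RatFunc ℝ) :=
  transfer (P.A + P.B₂ * Kd) (-Ld) P.C₂ 1

/-- Denominator of the left factorization `G = M̃⁻¹ Ñ`. -/
def leftM : Matrix (Fin k₁ ⊕ Fin k₂) (Fin k₁ ⊕ Fin k₂) (RatFunc ℝ) :=
  transfer (P.A + Ld * P.C₂) Ld P.C₂ 1

/-- Numerator of the left factorization `G = M̃⁻¹ Ñ`. -/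
def leftN : Matrix (Fin k₁ ⊕ Fin k₂) (Fin m₁ ⊕ Fin m₂) (RatFunc ℝ) :=
  transfer (P.A + Ld * P.C₂) P.B₂ P.C₂ 0

/-- Numerator of the left factorization `X̃⁻¹ Ỹ` of the observer-based controller. -/
def leftY : Matrix (Fin m₁ ⊕ Fin m₂) (Fin k₁ ⊕ Fin k₂) (RatFunc ℝ) :=
  transfer (P.A + Ld * P.C₂) (-Ld) Kd 0

/-- Denominator of the left factorization `X̃⁻¹ Ỹ` of the observer-based controller. -/
def leftX : Matrix (Fin m₁ ⊕ Fin m₂) (Fin m₁ ⊕ Fin m₂) (RatFunc ℝ) :=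
  transfer (P.A + Ld * P.C₂) (-P.B₂) Kd 1

theorem leftM_mul_G : P.leftM Ld * P.G = P.leftN Ld := by
  simp only [leftM, G, leftN, transfer_eq, const_zero, const_one, zero_add, Matrix.add_mul,
    Matrix.mul_assoc, Matrix.one_mul, resolventMatrix_add_mul_resolventMatrix, Matrix.mul_sub]
  abel

theorem G_mul_rightM : P.G * P.rightM Kd = P.rightN Kd := by
  simp only [rightM, G, rightN, transfer_eq, const_zero, const_one, zero_add, Matrix.mul_add,
    Matrix.mul_assoc, Matrix.mul_one, resolventMatrix_mul_resolventMatrix_add, Matrix.mul_sub]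
  abel

theorem leftM_mul_rightN : P.leftM Ld * P.rightN Kd = P.leftN Ld * P.rightM Kd := by
  rw [← G_mul_rightM, ← leftM_mul_G, Matrix.mul_assoc]

/-- Bezout identity `M̃ X - Ñ Y = 1`. -/
theorem leftM_mul_rightX_sub :
    P.leftM Ld * P.rightX Kd Ld - P.leftN Ld * P.rightY Kd Ld = 1 := by
  simp only [leftM, rightX, leftN, rightY, transfer_eq, const_zero, const_one, const_neg, zero_add,
    Matrix.mul_add, Matrix.add_mul, Matrix.mul_neg, Matrix.mul_assoc, Matrix.mul_one,
    Matrix.one_mul, resolventMatrix_add_mul_resolventMatrix_add, Matrix.mul_sub]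
  abel

/-- Bezout identity `X̃ M - Ỹ N = 1`. -/
theorem leftX_mul_rightM_sub :
    P.leftX Kd Ld * P.rightM Kd - P.leftY Kd Ld * P.rightN Kd = 1 := by
  simp only [leftX, rightM, leftY, rightN, transfer_eq, const_zero, const_one, const_neg, zero_add,
    Matrix.mul_add, Matrix.add_mul, Matrix.mul_neg, Matrix.neg_mul, Matrix.mul_assoc,
    Matrix.mul_one, Matrix.one_mul, resolventMatrix_add_mul_resolventMatrix_add, Matrix.mul_sub]
  abel

theorem rightY_mul_leftM : P.rightY Kd Ld * P.leftM Ld = P.rightM Kd * P.leftY Kd Ld := by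
  simp only [leftM, rightM, leftY, rightY, transfer_eq, const_zero, const_one, const_neg, zero_add,
    Matrix.mul_add, Matrix.add_mul, Matrix.mul_neg, Matrix.neg_mul, Matrix.mul_assoc,
    Matrix.mul_one, Matrix.one_mul, resolventMatrix_add_mul_resolventMatrix_add, Matrix.mul_sub]
  abel

theorem one_add_rightY_mul_leftN :
    1 + P.rightY Kd Ld * P.leftN Ld = P.rightM Kd * P.leftX Kd Ld := by
  simp only [leftN, rightM, leftX, rightY, transfer_eq, const_zero, const_one, const_neg, zero_add,
    Matrix.mul_add, Matrix.add_mul, Matrix.mul_neg, Matrix.neg_mul, Matrix.mul_assoc,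
    Matrix.mul_one, Matrix.one_mul, resolventMatrix_add_mul_resolventMatrix_add, Matrix.mul_sub]
  abel

/-! ### The blocks of the plant, of `J_d` and of `T` -/

theorem tf_eq : P.tf = fromBlocks (transfer P.A P.B₁ P.C₁ 0) (transfer P.A P.B₂ P.C₁ P.D₁₂)
    (transfer P.A P.B₁ P.C₂ P.D₂₁) P.G :=
  transfer_fromBlocks _ _ _ _ _ _ _ _ _

theorem Jd_eq : P.Jd Kd Ld = fromBlocks
    (transfer (P.A + P.B₂ * Kd + Ld * P.C₂) (-Ld) Kd 0)
    (transfer (P.A + P.B₂ * Kd + Ld * P.C₂) P.B₂ Kd 1)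
    (transfer (P.A + P.B₂ * Kd + Ld * P.C₂) (-Ld) (-P.C₂) 1)
    (transfer (P.A + P.B₂ * Kd + Ld * P.C₂) P.B₂ (-P.C₂) 0) :=
  transfer_fromBlocks _ _ _ _ _ _ _ _ _

theorem Jd_toBlocks₂₁_mul_rightX : (P.Jd Kd Ld).toBlocks₂₁ * P.rightX Kd Ld = 1 := by
  simp only [Jd_eq, toBlocks_fromBlocks₂₁, rightX, transfer_eq, const_one,
    const_neg, Matrix.mul_add, Matrix.add_mul, Matrix.mul_neg, Matrix.neg_mul, Matrix.mul_assoc,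
    Matrix.mul_one, Matrix.one_mul, resolventMatrix_add_mul_resolventMatrix, Matrix.mul_sub]
  abel

theorem Jd_toBlocks₁₁ :
    (P.Jd Kd Ld).toBlocks₁₁ = P.rightY Kd Ld * (P.Jd Kd Ld).toBlocks₂₁ := by
  simp only [Jd_eq, toBlocks_fromBlocks₂₁, toBlocks_fromBlocks₁₁, rightY,
    transfer_eq, const_one, const_zero, zero_add,
    const_neg, Matrix.mul_add, Matrix.mul_neg, Matrix.neg_mul, Matrix.mul_assoc,
    Matrix.mul_one, resolventMatrix_mul_resolventMatrix_add, Matrix.mul_sub]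
  abel

theorem Jd_toBlocks₂₂ :
    (P.Jd Kd Ld).toBlocks₂₂ = -((P.Jd Kd Ld).toBlocks₂₁ * P.rightN Kd) := by
  simp only [Jd_eq, toBlocks_fromBlocks₂₁, toBlocks_fromBlocks₂₂, rightN,
    transfer_eq, const_one, const_zero, zero_add,
    const_neg, Matrix.add_mul, Matrix.mul_neg, Matrix.neg_mul, Matrix.mul_assoc,
    Matrix.one_mul, resolventMatrix_add_mul_resolventMatrix, Matrix.mul_sub]
  abel

theorem Jd_toBlocks₁₂ :
    (P.Jd Kd Ld).toBlocks₁₂ = P.rightM Kd - (P.Jd Kd Ld).toBlocks₁₁ * P.rightN Kd := by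
  simp only [Jd_eq, toBlocks_fromBlocks₁₁, toBlocks_fromBlocks₁₂, rightN, rightM,
    transfer_eq, const_one, const_zero, zero_add,
    const_neg, Matrix.mul_neg, Matrix.neg_mul, Matrix.mul_assoc,
    resolventMatrix_add_mul_resolventMatrix, Matrix.mul_sub]
  abel

theorem T_eq :
    P.T Kd Ld = fromBlocks
      (transfer (P.A + P.B₂ * Kd) P.B₁ (P.C₁ + P.D₁₂ * Kd) 0 -
        transfer (P.A + P.B₂ * Kd) P.B₂ (P.C₁ + P.D₁₂ * Kd) P.D₁₂ *
          transfer (P.A + Ld * P.C₂) (P.B₁ + Ld * P.D₂₁) Kd 0)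
      (transfer (P.A + P.B₂ * Kd) P.B₂ (P.C₁ + P.D₁₂ * Kd) P.D₁₂)
      (transfer (P.A + Ld * P.C₂) (P.B₁ + Ld * P.D₂₁) P.C₂ P.D₂₁) 0 := by
  simp only [T, transfer_eq, const_fromBlocks, resolventMatrix_fromBlocks_zero₂₁,
    fromBlocks_multiply, fromBlocks_add, const_neg, const_zero, Matrix.zero_mul, Matrix.mul_zero,
    add_zero, zero_add]
  congr 1
  simp only [const_add, const_mul, Matrix.mul_add, Matrix.add_mul, Matrix.mul_neg, Matrix.neg_mul,
    Matrix.mul_assoc]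
  abel

theorem leftM_mul_tf_toBlocks₂₁ :
    P.leftM Ld * P.tf.toBlocks₂₁ = (P.T Kd Ld).toBlocks₂₁ := by
  rw [tf_eq, T_eq, toBlocks_fromBlocks₂₁, toBlocks_fromBlocks₂₁]
  simp only [leftM, transfer_eq, const_add, const_mul, const_one, Matrix.mul_add, Matrix.add_mul,
    Matrix.mul_assoc, Matrix.one_mul, resolventMatrix_add_mul_resolventMatrix, Matrix.mul_sub]
  abel

theorem tf_toBlocks₁₂_mul_rightM :
    P.tf.toBlocks₁₂ * P.rightM Kd = (P.T Kd Ld).toBlocks₁₂ := by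
  rw [tf_eq, T_eq, toBlocks_fromBlocks₁₂, toBlocks_fromBlocks₁₂]
  simp only [rightM, transfer_eq, const_add, const_mul, const_one, Matrix.mul_add, Matrix.add_mul,
    Matrix.mul_assoc, Matrix.mul_one, resolventMatrix_mul_resolventMatrix_add, Matrix.mul_sub]
  abel

theorem tf_toBlocks₁₁_add :
    P.tf.toBlocks₁₁ + (P.T Kd Ld).toBlocks₁₂ * (P.leftY Kd Ld * P.tf.toBlocks₂₁) =
      (P.T Kd Ld).toBlocks₁₁ := by
  rw [tf_eq, T_eq, toBlocks_fromBlocks₁₁, toBlocks_fromBlocks₁₁, toBlocks_fromBlocks₁₂,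
    toBlocks_fromBlocks₂₁]
  simp only [leftY, transfer_eq, const_add, const_mul, const_neg, const_zero, zero_add,
    Matrix.mul_add, Matrix.add_mul, Matrix.mul_neg, Matrix.neg_mul, Matrix.mul_assoc,
    resolventMatrix_add_mul_resolventMatrix,
    Matrix.mul_sub]
  abel

end Plant

namespace Plant

variable {n₁ n₂ m₁ m₂ k₁ k₂ p q : ℕ} {P : Plant n₁ n₂ m₁ m₂ k₁ k₂ p q}
  {Kd : Matrix (Fin m₁ ⊕ Fin m₂) (Fin n₁ ⊕ Fin n₂) ℝ}
  {Ld : Matrix (Fin n₁ ⊕ Fin n₂) (Fin k₁ ⊕ Fin k₂) ℝ}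
  {K Q : Matrix (Fin m₁ ⊕ Fin m₂) (Fin k₁ ⊕ Fin k₂) (RatFunc ℝ)}

/-! ### The Youla parameterization -/

theorem isWellPosed_tf (K : Matrix (Fin m₁ ⊕ Fin m₂) (Fin k₁ ⊕ Fin k₂) (RatFunc ℝ)) :
    IsWellPosed P.tf K := by
  have h : P.tf.toBlocks₂₂.map valueAtInfinity = 0 := by
    rw [tf_eq, toBlocks_fromBlocks₂₂]
    ext i j
    exact valueAtInfinity_eq_zero (transfer_zero_strictlyProper P.A P.B₂ P.C₂ i j)
  rw [IsWellPosed, h, Matrix.zero_mul, sub_zero]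
  exact isUnit_one

/-- As `X` equals the identity at infinity and `N` vanishes there, `X + N Q` is the identity plus a
strictly proper matrix when `Q` is proper. -/
theorem rightX_add_eq_one_add :
    P.rightX Kd Ld + P.rightN Kd * Q =
      1 + (transfer (P.A + P.B₂ * Kd) (-Ld) P.C₂ 0 + P.rightN Kd * Q) := by
  rw [rightX, transfer_one, add_assoc]

theorem strictlyProper_transfer_add (hQ : Q ∈ MatrixOver properSubring _ _) :
    transfer (P.A + P.B₂ * Kd) (-Ld) P.C₂ 0 + P.rightN Kd * Q ∈ MatrixOver StrictlyProper _ _ :=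
  .strictlyProper_add (transfer_zero_strictlyProper _ _ _)
    (.strictlyProper_mul (transfer_zero_strictlyProper _ _ _) hQ)

theorem isUnit_rightX_add (hQ : Q ∈ MatrixOver properSubring _ _) :
    IsUnit (P.rightX Kd Ld + P.rightN Kd * Q) := by
  rw [rightX_add_eq_one_add]
  exact MatrixOver.isUnit_one_add (strictlyProper_transfer_add hQ)

/-- The controller `F_ℓ(J_d, Q)` is `(Y + M Q) (X + N Q)⁻¹`. -/
theorem lowerLFT_Jd_mul (hQ : Q ∈ MatrixOver properSubring _ _) :
    lowerLFT (P.Jd Kd Ld) Q * (P.rightX Kd Ld + P.rightN Kd * Q) =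
      P.rightY Kd Ld + P.rightM Kd * Q := by
  have hJX := P.Jd_toBlocks₂₁_mul_rightX Kd Ld
  have hXJ := mul_eq_one_comm.1 hJX
  set S := P.rightX Kd Ld + P.rightN Kd * Q with hSdef
  set J₂₁ := (P.Jd Kd Ld).toBlocks₂₁ with hJ₂₁
  have hS : IsUnit S.det := (isUnit_iff_isUnit_det _).1 (isUnit_rightX_add hQ)
  have hden : 1 - (P.Jd Kd Ld).toBlocks₂₂ * Q = J₂₁ * S := by
    rw [Jd_toBlocks₂₂, ← hJ₂₁, hSdef, Matrix.mul_add, hJX, Matrix.neg_mul, sub_neg_eq_add,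
      Matrix.mul_assoc]
  have hinv : (1 - (P.Jd Kd Ld).toBlocks₂₂ * Q)⁻¹ * J₂₁ * S = 1 := by
    rw [hden, Matrix.mul_inv_rev, inv_eq_right_inv hJX, Matrix.mul_assoc S⁻¹, hXJ, Matrix.mul_one,
      nonsing_inv_mul _ hS]
  rw [lowerLFT, ← hJ₂₁, Matrix.add_mul]
  simp only [Matrix.mul_assoc] at hinv ⊢
  rw [hinv, Matrix.mul_one, Jd_toBlocks₁₂, hSdef, Matrix.mul_add, Jd_toBlocks₁₁, ← hJ₂₁,
    Matrix.sub_mul, Matrix.mul_assoc _ J₂₁, hJX, Matrix.mul_one, Matrix.mul_assoc, Matrix.mul_assoc,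
    Matrix.mul_assoc]
  abel

/-- The relation `K (X + N Q) = Y + M Q` between controller and parameter, as a linear equation
for `Q`. -/
theorem rightM_sub_mul_eq_iff :
    (P.rightM Kd - K * P.rightN Kd) * Q = K * P.rightX Kd Ld - P.rightY Kd Ld ↔
      K * (P.rightX Kd Ld + P.rightN Kd * Q) = P.rightY Kd Ld + P.rightM Kd * Q := by
  rw [Matrix.sub_mul, Matrix.mul_add, Matrix.mul_assoc, sub_eq_sub_iff_add_eq_add, eq_comm,
    add_comm (P.rightM Kd * Q)]

theorem isUnit_rightM_sub (hK : K ∈ MatrixOver properSubring _ _) :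
    IsUnit (P.rightM Kd - K * P.rightN Kd) := by
  have h : P.rightM Kd - K * P.rightN Kd =
      1 + (transfer (P.A + P.B₂ * Kd) P.B₂ Kd 0 + -(K * P.rightN Kd)) := by
    rw [rightM, transfer_one]
    abel
  rw [h]
  exact MatrixOver.isUnit_one_add (.strictlyProper_add (transfer_zero_strictlyProper _ _ _)
    (.strictlyProper_neg (.mul_strictlyProper hK (transfer_zero_strictlyProper _ _ _))))

theorem lowerLFT_Jd_eq (hQ : Q ∈ MatrixOver properSubring _ _) :
    lowerLFT (P.Jd Kd Ld) Q =
      (P.rightY Kd Ld + P.rightM Kd * Q) * (P.rightX Kd Ld + P.rightN Kd * Q)⁻¹ := by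
  rw [← lowerLFT_Jd_mul hQ, Matrix.mul_assoc,
    mul_nonsing_inv _ ((isUnit_iff_isUnit_det _).1 (isUnit_rightX_add hQ)), Matrix.mul_one]

theorem lowerLFT_Jd_proper (hQ : Q ∈ MatrixOver properSubring _ _) :
    lowerLFT (P.Jd Kd Ld) Q ∈ MatrixOver properSubring _ _ := by
  rw [lowerLFT_Jd_eq hQ, rightX_add_eq_one_add]
  refine .mul (.add ?_ (.mul ?_ hQ)) (MatrixOver.inv_one_add (strictlyProper_transfer_add hQ))
  · exact fun i j => mem_Rp_iff.2 (le_of_lt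
      (transfer_zero_strictlyProper (P.A + P.B₂ * Kd) (-Ld) Kd i j))
  · rw [rightM, transfer_one]
    exact .add .one fun i j => mem_Rp_iff.2 (le_of_lt
      (transfer_zero_strictlyProper (P.A + P.B₂ * Kd) P.B₂ Kd i j))

theorem injOn_lowerLFT_Jd :
    Set.InjOn (lowerLFT (P.Jd Kd Ld)) (MatrixOver properSubring _ _) := by
  intro Q hQ Q' hQ' h
  have h₁ := rightM_sub_mul_eq_iff.2 (lowerLFT_Jd_mul (P := P) (Kd := Kd) (Ld := Ld) hQ)
  have h₂ := rightM_sub_mul_eq_iff.2 (lowerLFT_Jd_mul (P := P) (Kd := Kd) (Ld := Ld) hQ')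
  rw [← h, ← h₁] at h₂
  have hu := (isUnit_iff_isUnit_det _).1
    (isUnit_rightM_sub (P := P) (Kd := Kd) (lowerLFT_Jd_proper (P := P) (Kd := Kd) (Ld := Ld) hQ))
  rw [← nonsing_inv_mul_cancel_left _ Q hu, ← h₂, nonsing_inv_mul_cancel_left _ _ hu]

/-- The Bezout identity shows that `M̃`, the left denominator of `G`, inverts
`(X + N Q) - G (Y + M Q)`. -/
theorem rightX_add_sub_mul_leftM :
    (P.rightX Kd Ld + P.rightN Kd * Q - P.G * (P.rightY Kd Ld + P.rightM Kd * Q)) * P.leftM Ld =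
      1 := by
  rw [mul_eq_one_comm, ← leftM_mul_rightX_sub P Kd Ld, Matrix.mul_sub, ← Matrix.mul_assoc,
    leftM_mul_G, Matrix.mul_add, Matrix.mul_add, ← Matrix.mul_assoc, ← Matrix.mul_assoc,
    leftM_mul_rightN]
  abel

/-- The loop map of the controller with parameter `Q` is affine in `Q`. -/
theorem loopMap_lowerLFT_Jd (hQ : Q ∈ MatrixOver properSubring _ _) :
    loopMap P.tf (lowerLFT (P.Jd Kd Ld) Q) =
      fromBlocks ((P.rightX Kd Ld + P.rightN Kd * Q) * P.leftM Ld)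
        ((P.rightX Kd Ld + P.rightN Kd * Q) * P.leftN Ld)
        ((P.rightY Kd Ld + P.rightM Kd * Q) * P.leftM Ld)
        (1 + (P.rightY Kd Ld + P.rightM Kd * Q) * P.leftN Ld) := by
  have hK := lowerLFT_Jd_mul (P := P) (Kd := Kd) (Ld := Ld) hQ
  have h1 := rightX_add_sub_mul_leftM (P := P) (Kd := Kd) (Ld := Ld) (Q := Q)
  have hG : P.tf.toBlocks₂₂ = P.G := by rw [tf_eq, toBlocks_fromBlocks₂₂]
  set S := P.rightX Kd Ld + P.rightN Kd * Q
  set R := P.rightY Kd Ld + P.rightM Kd * Q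
  rw [loopMap, hG]
  refine inv_eq_right_inv ?_
  rw [fromBlocks_multiply]
  refine Eq.trans ?_ fromBlocks_one
  congr 1
  · refine Eq.trans ?_ h1
    simp only [Matrix.one_mul, Matrix.neg_mul, Matrix.add_mul, Matrix.mul_assoc, sub_eq_add_neg]
  · have h2 : (S - P.G * R) * P.leftN Ld = P.G := by
      rw [← leftM_mul_G, ← Matrix.mul_assoc, h1, Matrix.one_mul]
    rw [Matrix.sub_mul, Matrix.mul_assoc] at h2
    rw [Matrix.one_mul, Matrix.mul_add, Matrix.mul_one, Matrix.neg_mul]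
    refine Eq.trans ?_ (sub_eq_zero.2 h2)
    abel
  · rw [Matrix.neg_mul, ← Matrix.mul_assoc, hK, Matrix.one_mul, neg_add_cancel]
  · rw [Matrix.neg_mul, ← Matrix.mul_assoc, hK, Matrix.one_mul]
    abel

/-- The closed-loop map from `w` to `z` is affine in `Q`, because `Y M̃ = M Ỹ` lets the factor
`P₁₂` meet `M`. -/
theorem tf_toBlocks₁₁_add_mul :
    P.tf.toBlocks₁₁ + P.tf.toBlocks₁₂ * ((P.rightY Kd Ld + P.rightM Kd * Q) * P.leftM Ld) *
      P.tf.toBlocks₂₁ =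
      (P.T Kd Ld).toBlocks₁₁ + (P.T Kd Ld).toBlocks₁₂ * Q * (P.T Kd Ld).toBlocks₂₁ := by
  rw [← tf_toBlocks₁₁_add, ← leftM_mul_tf_toBlocks₂₁, ← tf_toBlocks₁₂_mul_rightM (Ld := Ld),
    Matrix.add_mul, rightY_mul_leftM]
  simp only [Matrix.mul_add, Matrix.add_mul, Matrix.mul_assoc]
  abel

/-- The two problems have the same cost: `F_ℓ(P, F_ℓ(J_d, Q)) = T₁₁ + T₁₂ Q T₂₁`. -/
theorem lowerLFT_tf_lowerLFT_Jd (hQ : Q ∈ MatrixOver properSubring _ _) :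
    lowerLFT P.tf (lowerLFT (P.Jd Kd Ld) Q) =
      (P.T Kd Ld).toBlocks₁₁ + (P.T Kd Ld).toBlocks₁₂ * Q * (P.T Kd Ld).toBlocks₂₁ := by
  have hK := lowerLFT_Jd_mul (P := P) (Kd := Kd) (Ld := Ld) hQ
  have h1 := rightX_add_sub_mul_leftM (P := P) (Kd := Kd) (Ld := Ld) (Q := Q)
  have hG : P.tf.toBlocks₂₂ = P.G := by rw [tf_eq, toBlocks_fromBlocks₂₂]
  have hinv : (1 - P.tf.toBlocks₂₂ * lowerLFT (P.Jd Kd Ld) Q)⁻¹ =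
      (P.rightX Kd Ld + P.rightN Kd * Q) * P.leftM Ld := by
    refine inv_eq_right_inv ?_
    rw [← Matrix.mul_assoc, Matrix.sub_mul, Matrix.one_mul, hG, Matrix.mul_assoc P.G, hK, h1]
  rw [← tf_toBlocks₁₁_add_mul, lowerLFT, hinv, ← hK]
  simp only [Matrix.mul_assoc]

/-- A stable parameter gives a stable closed loop: multiplied by the loop map, the unstable blocks
of the plant only occur in the combinations `P₁₂ M = T₁₂` and `M̃ P₂₁ = T₂₁`. -/
theorem closedLoopMap_stable (hAK : IsHurwitz (P.A + P.B₂ * Kd))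
    (hAL : IsHurwitz (P.A + Ld * P.C₂)) (hQ : Q ∈ MatrixOver stableSubring _ _) :
    closedLoopMap P.tf (lowerLFT (P.Jd Kd Ld) Q) ∈ MatrixOver stableSubring _ _ := by
  have hM : P.rightM Kd ∈ MatrixOver stableSubring _ _ := transfer_stable hAK _ _ _
  have hN : P.rightN Kd ∈ MatrixOver stableSubring _ _ := transfer_stable hAK _ _ _
  have hY : P.rightY Kd Ld ∈ MatrixOver stableSubring _ _ := transfer_stable hAK _ _ _
  have hX : P.rightX Kd Ld ∈ MatrixOver stableSubring _ _ := transfer_stable hAK _ _ _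
  have hM' : P.leftM Ld ∈ MatrixOver stableSubring _ _ := transfer_stable hAL _ _ _
  have hN' : P.leftN Ld ∈ MatrixOver stableSubring _ _ := transfer_stable hAL _ _ _
  have hY' : P.leftY Kd Ld ∈ MatrixOver stableSubring _ _ := transfer_stable hAL _ _ _
  have hX' : P.leftX Kd Ld ∈ MatrixOver stableSubring _ _ := transfer_stable hAL _ _ _
  have hT₁₂ : (P.T Kd Ld).toBlocks₁₂ ∈ MatrixOver stableSubring _ _ := by
    rw [T_eq, toBlocks_fromBlocks₁₂]
    exact transfer_stable hAK _ _ _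
  have hT₂₁ : (P.T Kd Ld).toBlocks₂₁ ∈ MatrixOver stableSubring _ _ := by
    rw [T_eq, toBlocks_fromBlocks₂₁]
    exact transfer_stable hAL _ _ _
  have hT₁₁ : (P.T Kd Ld).toBlocks₁₁ ∈ MatrixOver stableSubring _ _ := by
    rw [T_eq, toBlocks_fromBlocks₁₁]
    exact .sub (transfer_stable hAK _ _ _)
      (.mul (transfer_stable hAK _ _ _) (transfer_stable hAL _ _ _))
  have hS := MatrixOver.add hX (.mul hN hQ)
  have hR := MatrixOver.add hY (.mul hM hQ)
  rw [closedLoopMap, loopMap_lowerLFT_Jd (MatrixOver.proper_of_stable hQ)]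
  simp only [fromCols_mul_fromBlocks, fromCols_mul_fromRows, fromBlocks_mul_fromRows,
    Matrix.zero_mul, Matrix.mul_zero, zero_add, add_zero]
  refine .fromBlocks ?_ (.fromCols ?_ ?_) (.fromRows ?_ ?_)
    (.fromBlocks (.mul hS hM') (.mul hS hN') (.mul hR hM') (.add .one (.mul hR hN')))
  · rw [tf_toBlocks₁₁_add_mul]
    exact .add hT₁₁ (.mul (.mul hT₁₂ hQ) hT₂₁)
  · have h : P.tf.toBlocks₁₂ * ((P.rightY Kd Ld + P.rightM Kd * Q) * P.leftM Ld) =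
        (P.T Kd Ld).toBlocks₁₂ * (P.leftY Kd Ld + Q * P.leftM Ld) := by
      rw [← tf_toBlocks₁₂_mul_rightM, Matrix.add_mul, rightY_mul_leftM]
      simp only [Matrix.mul_add, Matrix.mul_assoc]
    rw [h]
    exact .mul hT₁₂ (.add hY' (.mul hQ hM'))
  · have h : P.tf.toBlocks₁₂ * (1 + (P.rightY Kd Ld + P.rightM Kd * Q) * P.leftN Ld) =
        (P.T Kd Ld).toBlocks₁₂ * (P.leftX Kd Ld + Q * P.leftN Ld) := by
      rw [← tf_toBlocks₁₂_mul_rightM, Matrix.add_mul, ← add_assoc, one_add_rightY_mul_leftN]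
      simp only [Matrix.mul_add, Matrix.mul_assoc]
    rw [h]
    exact .mul hT₁₂ (.add hX' (.mul hQ hN'))
  · rw [Matrix.mul_assoc, leftM_mul_tf_toBlocks₂₁ P Kd]
    exact .mul hS hT₂₁
  · rw [Matrix.mul_assoc, leftM_mul_tf_toBlocks₂₁ P Kd]
    exact .mul hR hT₂₁

/-- The parameter of a stabilizing controller is stable: `(M - K N)⁻¹ (K X - Y)` is a polynomial
in the entries of the stable loop map and of the stable coprime factors. -/
theorem exists_stable_parameter (hAK : IsHurwitz (P.A + P.B₂ * Kd))
    (hAL : IsHurwitz (P.A + Ld * P.C₂)) (hK : K ∈ MatrixOver properSubring _ _)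
    (hH : loopMap P.tf K ∈ MatrixOver stableSubring _ _) :
    (P.rightM Kd - K * P.rightN Kd)⁻¹ * (K * P.rightX Kd Ld - P.rightY Kd Ld) ∈
      MatrixOver stableSubring _ _ := by
  have hG : P.tf.toBlocks₂₂ = P.G := by rw [tf_eq, toBlocks_fromBlocks₂₂]
  have hGsp : P.G ∈ MatrixOver StrictlyProper _ _ := transfer_zero_strictlyProper _ _ _
  have hunit : IsUnit (fromBlocks 1 (-P.G) (-K) 1 :
      Matrix ((Fin k₁ ⊕ Fin k₂) ⊕ (Fin m₁ ⊕ Fin m₂)) _ (RatFunc ℝ)) := by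
    rw [isUnit_iff_isUnit_det, det_fromBlocks_one₁₁, ← isUnit_iff_isUnit_det, Matrix.neg_mul,
      Matrix.mul_neg, neg_neg, sub_eq_add_neg]
    exact MatrixOver.isUnit_one_add (.strictlyProper_neg (.mul_strictlyProper hK hGsp))
  have hloop := nonsing_inv_mul _ ((isUnit_iff_isUnit_det _).1 hunit)
  rw [loopMap, hG] at hH
  set H := (fromBlocks 1 (-P.G) (-K) 1 :
    Matrix ((Fin k₁ ⊕ Fin k₂) ⊕ (Fin m₁ ⊕ Fin m₂)) _ (RatFunc ℝ))⁻¹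
  have h₁₁ : H.toBlocks₁₁ ∈ MatrixOver stableSubring _ _ := fun i j => hH _ _
  have h₁₂ : H.toBlocks₁₂ ∈ MatrixOver stableSubring _ _ := fun i j => hH _ _
  have h₂₁ : H.toBlocks₂₁ ∈ MatrixOver stableSubring _ _ := fun i j => hH _ _
  have h₂₂ : H.toBlocks₂₂ ∈ MatrixOver stableSubring _ _ := fun i j => hH _ _
  rw [← fromBlocks_toBlocks H, fromBlocks_multiply] at hloop
  replace hloop := hloop.trans fromBlocks_one.symm
  rw [fromBlocks_inj] at hloop
  obtain ⟨e₁₁, e₁₂, e₂₁, e₂₂⟩ := hloop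
  simp only [Matrix.mul_one, Matrix.mul_neg] at e₁₁ e₁₂ e₂₁ e₂₂
  rw [← sub_eq_add_neg] at e₁₁ e₂₁
  replace e₁₁ : H.toBlocks₁₂ * K = H.toBlocks₁₁ - 1 := by rw [← e₁₁]; abel
  replace e₁₂ : H.toBlocks₁₂ = H.toBlocks₁₁ * P.G := by rwa [neg_add_eq_zero, eq_comm] at e₁₂
  replace e₂₁ : H.toBlocks₂₂ * K = H.toBlocks₂₁ := (sub_eq_zero.1 e₂₁).symm
  replace e₂₂ : H.toBlocks₂₂ - H.toBlocks₂₁ * P.G = 1 := by rw [← e₂₂]; abel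
  have hN := G_mul_rightM P Kd
  have hinv : (P.leftX Kd Ld * H.toBlocks₂₂ - P.leftY Kd Ld * H.toBlocks₁₂) *
      (P.rightM Kd - K * P.rightN Kd) = 1 := by
    have a₂ : H.toBlocks₂₂ * (P.rightM Kd - K * P.rightN Kd) = P.rightM Kd := by
      rw [Matrix.mul_sub, ← Matrix.mul_assoc, e₂₁, ← hN, ← Matrix.mul_assoc, ← Matrix.sub_mul,
        e₂₂, Matrix.one_mul]
    have a₁ : H.toBlocks₁₂ * (P.rightM Kd - K * P.rightN Kd) = P.rightN Kd := by
      rw [Matrix.mul_sub, ← Matrix.mul_assoc _ K, e₁₁, Matrix.sub_mul, e₁₂, Matrix.mul_assoc, hN,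
        Matrix.one_mul, sub_sub_cancel]
    rw [Matrix.sub_mul, Matrix.mul_assoc, Matrix.mul_assoc, a₁, a₂, leftX_mul_rightM_sub]
  have hformula : (P.rightM Kd - K * P.rightN Kd)⁻¹ * (K * P.rightX Kd Ld - P.rightY Kd Ld) =
      (P.leftX Kd Ld * H.toBlocks₂₁ - P.leftY Kd Ld * (H.toBlocks₁₁ - 1)) * P.rightX Kd Ld -
      (P.leftX Kd Ld * H.toBlocks₂₂ - P.leftY Kd Ld * H.toBlocks₁₂) * P.rightY Kd Ld := by
    rw [inv_eq_left_inv hinv, ← e₁₁, ← e₂₁]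
    simp only [Matrix.mul_sub, Matrix.sub_mul, Matrix.mul_assoc]
  rw [hformula]
  -- the right factors `X`, `Y` inherit stability from `A + B₂ Kd`, the left ones from `A + Ld C₂`
  exact .sub (.mul (.sub (.mul (transfer_stable hAL _ _ _) h₂₁)
      (.mul (transfer_stable hAL _ _ _) (.sub h₁₁ .one))) (transfer_stable hAK _ _ _))
    (.mul (.sub (.mul (transfer_stable hAL _ _ _) h₂₂) (.mul (transfer_stable hAL _ _ _) h₁₂))
      (transfer_stable hAK _ _ _))

/-- The structured Youla parameterization. Block lower triangular gains make all coprime factors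
block lower triangular, and so the correspondence between `Q` and `K` preserves this structure in
both directions. -/
theorem image_lowerLFT_Jd (hAK : IsHurwitz (P.A + P.B₂ * Kd)) (hAL : IsHurwitz (P.A + Ld * P.C₂))
    (hKd : Kd.toBlocks₁₂ = 0) (hLd : Ld.toBlocks₁₂ = 0) :
    lowerLFT (P.Jd Kd Ld) '' Lower RHinf m₁ m₂ k₁ k₂ = P.controllers := by
  have hC : P.C₂.toBlocks₁₂ = 0 := toBlocks_fromBlocks₁₂ _ _ _ _
  have hB : P.B₂.toBlocks₁₂ = 0 := toBlocks_fromBlocks₁₂ _ _ _ _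
  have hA : (P.A + P.B₂ * Kd).toBlocks₁₂ = 0 := by
    rw [← fromBlocks_toBlocks Kd, hKd, A, B₂, fromBlocks_multiply, fromBlocks_add]
    simp
  have hL' : (-Ld).toBlocks₁₂ = 0 := by
    rw [← fromBlocks_toBlocks Ld, hLd, fromBlocks_neg]
    simp
  have h1 {a₁ a₂ : ℕ} : (1 : Matrix (Fin a₁ ⊕ Fin a₂) (Fin a₁ ⊕ Fin a₂) ℝ).toBlocks₁₂ = 0 := by
    rw [← fromBlocks_one, toBlocks_fromBlocks₁₂]
  have h0 {a₁ a₂ b₁ b₂ : ℕ} :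
      (0 : Matrix (Fin a₁ ⊕ Fin a₂) (Fin b₁ ⊕ Fin b₂) ℝ).toBlocks₁₂ = 0 := rfl
  have hM : (P.rightM Kd).toBlocks₁₂ = 0 := toBlocks₁₂_transfer_eq_zero hA hB hKd h1
  have hN : (P.rightN Kd).toBlocks₁₂ = 0 := toBlocks₁₂_transfer_eq_zero hA hB hC h0
  have hY : (P.rightY Kd Ld).toBlocks₁₂ = 0 := toBlocks₁₂_transfer_eq_zero hA hL' hKd h0
  have hX : (P.rightX Kd Ld).toBlocks₁₂ = 0 := toBlocks₁₂_transfer_eq_zero hA hL' hC h1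
  apply Set.Subset.antisymm
  · rintro _ ⟨Q, ⟨hQ, hQ₁₂⟩, rfl⟩
    have hQp : Q ∈ MatrixOver properSubring _ _ :=
      MatrixOver.proper_of_stable (hQ : Q ∈ MatrixOver stableSubring _ _)
    refine ⟨⟨lowerLFT_Jd_proper hQp, ?_⟩, isWellPosed_tf _, closedLoopMap_stable hAK hAL hQ⟩
    rw [lowerLFT_Jd_eq hQp]
    exact toBlocks₁₂_mul_eq_zero (toBlocks₁₂_add_eq_zero hY (toBlocks₁₂_mul_eq_zero hM hQ₁₂))
      (toBlocks₁₂_inv_eq_zero (toBlocks₁₂_add_eq_zero hX (toBlocks₁₂_mul_eq_zero hN hQ₁₂))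
        (isUnit_rightX_add hQp))
  · rintro K ⟨⟨hK, hK₁₂⟩, -, hcl⟩
    replace hK : K ∈ MatrixOver properSubring _ _ := hK
    have hH : loopMap P.tf K ∈ MatrixOver stableSubring _ _ :=
      fun i j => hcl (Sum.inr i) (Sum.inr j)
    have hu := isUnit_rightM_sub (P := P) (Kd := Kd) hK
    set Q := (P.rightM Kd - K * P.rightN Kd)⁻¹ * (K * P.rightX Kd Ld - P.rightY Kd Ld) with hQdef
    have hQ : Q ∈ MatrixOver stableSubring _ _ := exists_stable_parameter hAK hAL hK hH
    have hQp := MatrixOver.proper_of_stable hQ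
    refine ⟨Q, ⟨hQ, ?_⟩, ?_⟩
    · exact toBlocks₁₂_mul_eq_zero (toBlocks₁₂_inv_eq_zero
        (toBlocks₁₂_sub_eq_zero hM (toBlocks₁₂_mul_eq_zero hK₁₂ hN)) hu)
        (toBlocks₁₂_sub_eq_zero (toBlocks₁₂_mul_eq_zero hK₁₂ hX) hY)
    · have hKS : K * (P.rightX Kd Ld + P.rightN Kd * Q) =
          P.rightY Kd Ld + P.rightM Kd * Q := by
        rw [← rightM_sub_mul_eq_iff, hQdef,
          mul_nonsing_inv_cancel_left _ _ ((isUnit_iff_isUnit_det _).1 hu)]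
      rw [lowerLFT_Jd_eq hQp, ← hKS, Matrix.mul_assoc,
        mul_nonsing_inv _ ((isUnit_iff_isUnit_det _).1 (isUnit_rightX_add hQp)), Matrix.mul_one]

end Plant

/-! ### Transport of minimizers -/

section Minimizers

variable {α β : Type*} {f : α → ENNReal} {g : β → ENNReal} {φ : α → β} {s u : Set α}

/-- Injectivity is needed on a set `u` larger than the feasible set `s`: otherwise an infeasible `x`
could share its image with a feasible point. -/
theorem isMinimizer_iff_of_injOn (hφ : Set.InjOn φ u) (hs : s ⊆ u)
    (hfg : ∀ x ∈ s, g (φ x) = f x) {x : α} (hx : x ∈ u) :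
    IsMinimizer f s x ↔ IsMinimizer g (φ '' s) (φ x) := by
  rw [IsMinimizer, IsMinimizer, hφ.mem_image_iff hs hx]
  refine and_congr_right fun hxs => ?_
  simp only [isMinOn_iff, Set.forall_mem_image]
  refine forall₂_congr fun y hy => ?_
  rw [hfg x hxs, hfg y hy]

theorem isUniqueMinimizer_iff_of_injOn (hφ : Set.InjOn φ u) (hs : s ⊆ u)
    (hfg : ∀ x ∈ s, g (φ x) = f x) {x : α} (hx : x ∈ u) :
    IsUniqueMinimizer f s x ↔ IsUniqueMinimizer g (φ '' s) (φ x) := by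
  rw [IsUniqueMinimizer, IsUniqueMinimizer, isMinimizer_iff_of_injOn hφ hs hfg hx]
  refine and_congr_right fun _ => ⟨fun h z hz => ?_, fun h y hy => ?_⟩
  · obtain ⟨y, hy, rfl⟩ := hz.1
    rw [h y ((isMinimizer_iff_of_injOn hφ hs hfg (hs hy)).2 hz)]
  · exact hφ (hs hy.1) hx (h _ ((isMinimizer_iff_of_injOn hφ hs hfg (hs hy.1)).1 hy))

theorem existsUnique_isMinimizer_iff_of_injOn (hφ : Set.InjOn φ u) (hs : s ⊆ u)
    (hfg : ∀ x ∈ s, g (φ x) = f x) :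
    (∃! x, IsMinimizer f s x) ↔ ∃! z, IsMinimizer g (φ '' s) z := by
  constructor
  · rintro ⟨x, hx⟩
    exact ⟨φ x, (isUniqueMinimizer_iff_of_injOn hφ hs hfg (hs hx.1.1)).1 hx⟩
  · rintro ⟨z, hz⟩
    obtain ⟨x, hx, rfl⟩ := hz.1.1
    exact ⟨x, (isUniqueMinimizer_iff_of_injOn hφ hs hfg (hs hx)).2 hz⟩

end Minimizers

end TwoPlayer

end

theorem mainTheorem5 (n₁ n₂ m₁ m₂ k₁ k₂ p q : ℕ) (P : Plant n₁ n₂ m₁ m₂ k₁ k₂ p q)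
    (hmin : IsMinimalRealization P.A P.B P.C P.D)
    (hs₁ : IsStabilizable P.A11 P.B11) (hd₁ : IsDetectable P.C11 P.A11)
    (hs₂ : IsStabilizable P.A22 P.B22) (hd₂ : IsDetectable P.C22 P.A22)
    (K₁ : Matrix (Fin m₁) (Fin n₁) ℝ) (K₂ : Matrix (Fin m₂) (Fin n₂) ℝ)
    (L₁ : Matrix (Fin n₁) (Fin k₁) ℝ) (L₂ : Matrix (Fin n₂) (Fin k₂) ℝ)
    (hK₁ : IsHurwitz (P.A11 + P.B11 * K₁)) (hK₂ : IsHurwitz (P.A22 + P.B22 * K₂))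
    (hL₁ : IsHurwitz (P.A11 + L₁ * P.C11)) (hL₂ : IsHurwitz (P.A22 + L₂ * P.C22))
    (Kd : Matrix (Fin m₁ ⊕ Fin m₂) (Fin n₁ ⊕ Fin n₂) ℝ) (hKd : Kd = Matrix.fromBlocks K₁ 0 0 K₂)
    (Ld : Matrix (Fin n₁ ⊕ Fin n₂) (Fin k₁ ⊕ Fin k₂) ℝ) (hLd : Ld = Matrix.fromBlocks L₁ 0 0 L₂) :
    -- the structured Youla parameterization of the stabilizing block-lower-triangular controllers
    lowerLFT (P.Jd Kd Ld) '' Lower RHinf m₁ m₂ k₁ k₂ = P.controllers ∧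
    -- `Q` solves the model-matching problem iff `F_ℓ(J_d, Q)` solves the two-player problem
    (∀ Q ∈ MatrixOver Rp (Fin m₁ ⊕ Fin m₂) (Fin k₁ ⊕ Fin k₂),
      (IsMinimizer (P.matchingCost Kd Ld) (Lower RHinf m₁ m₂ k₁ k₂) Q ↔
        IsMinimizer P.controlCost P.controllers (lowerLFT (P.Jd Kd Ld) Q))) ∧
    -- uniqueness of one is equivalent to uniqueness of the other
    (∀ Q ∈ MatrixOver Rp (Fin m₁ ⊕ Fin m₂) (Fin k₁ ⊕ Fin k₂),
      (IsUniqueMinimizer (P.matchingCost Kd Ld) (Lower RHinf m₁ m₂ k₁ k₂) Q ↔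
        IsUniqueMinimizer P.controlCost P.controllers (lowerLFT (P.Jd Kd Ld) Q))) ∧
    ((∃! Q, IsMinimizer (P.matchingCost Kd Ld) (Lower RHinf m₁ m₂ k₁ k₂) Q) ↔
      ∃! K, IsMinimizer P.controlCost P.controllers K) := by
  have hAK : IsHurwitz (P.A + P.B₂ * Kd) := by
    rw [hKd, Plant.A, Plant.B₂, Matrix.fromBlocks_multiply, Matrix.fromBlocks_add]
    simp only [Matrix.mul_zero, Matrix.zero_mul, add_zero, zero_add]
    exact hK₁.fromBlocks_zero₁₂ hK₂ _
  have hAL : IsHurwitz (P.A + Ld * P.C₂) := by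
    rw [hLd, Plant.A, Plant.C₂, Matrix.fromBlocks_multiply, Matrix.fromBlocks_add]
    simp only [Matrix.mul_zero, Matrix.zero_mul, add_zero, zero_add]
    exact hL₁.fromBlocks_zero₁₂ hL₂ _
  have himage := Plant.image_lowerLFT_Jd hAK hAL
    (by rw [hKd, Matrix.toBlocks_fromBlocks₁₂]) (by rw [hLd, Matrix.toBlocks_fromBlocks₁₂])
  have hinj : Set.InjOn (lowerLFT (P.Jd Kd Ld)) (MatrixOver Rp _ _) := Plant.injOn_lowerLFT_Jd
  have hsub : Lower RHinf m₁ m₂ k₁ k₂ ⊆ MatrixOver Rp _ _ := fun Q hQ i j => (hQ.1 i j).1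
  have hcost : ∀ Q ∈ Lower RHinf m₁ m₂ k₁ k₂,
      P.controlCost (lowerLFT (P.Jd Kd Ld) Q) = P.matchingCost Kd Ld Q := fun Q hQ => by
    rw [Plant.controlCost, Plant.lowerLFT_tf_lowerLFT_Jd (hsub hQ), Plant.matchingCost]
  rw [← himage]
  exact ⟨rfl, fun Q hQ => isMinimizer_iff_of_injOn hinj hsub hcost hQ,
    fun Q hQ => isUniqueMinimizer_iff_of_injOn hinj hsub hcost hQ,
    existsUnique_isMinimizer_iff_of_injOn hinj hsub hcost⟩
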